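/- Write $\mathbb R_+=(0,\infty)$. For $\alpha:\mathbb R_+\to\mathbb C$, $N\ge 0$ and tuples $\kappa_1\in\mathbb C^{k_1}$, $\lambda_1\in\mathbb C^{l_1}$, $\kappa_2\in\mathbb C^{k_2}$, $\lambda_2\in\mathbb C^{l_2}$, the $\kappa$'s having entries outside $[0,\infty)$, let $$Z^{(N)}_{k_1|l_1;k_2|l_2}(\kappa_1,\lambda_1;\kappa_2,\lambda_2)=\frac1{(N!)^2}\int_{\mathbb R_+^{2N}}\frac{\Delta_N^2(x)\Delta_N^2(y)}{\prod_{i,j=1}^N(x_i+y_j)}\prod_{j=1}^N\left(\alpha(x_j)\alpha(y_j)\,y_j\,\frac{\prod_{i=1}^{l_1}(x_j-\lambda_{1,i})\prod_{i=1}^{l_2}(y_j-\lambda_{2,i})}{\prod_{i=1}^{k_1}(x_j-\kappa_{1,i})\prod_{i=1}^{k_2}(y_j-\kappa_{2,i})}\right)dx\,dy$$ be the partition function of the Cauchy-like two-matrix model with weight $\alpha$, where $\Delta_n(u)=\prod_{1\le i<j\le n}(u_j-u_i)$. Write $Z^{(N)}=Z^{(N)}_{0|0;0|0}$ and $$B_{k|l}(\kappa;\lambda)=\frac{\Delta_k(\kappa)\Delta_l(\lambda)}{\prod_{i=1}^k\prod_{j=1}^l(\kappa_i-\lambda_j)}.$$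 Define the kernels $$\widehat K_{11}^{(L)}(\kappa_1,\kappa_2)=\frac{Z^{(L)}_{1|0;1|0}(\kappa_1;\kappa_2)-Z^{(L)}_{1|0;1|0}(\kappa_2;\kappa_1)}{2Z^{(L-1)}},\qquad \widehat K_{01}^{(L)}(\kappa,\lambda)=\frac{Z^{(L)}_{0|0;1|1}(\kappa,\lambda)+Z^{(L)}_{1|1;0|0}(\kappa,\lambda)}{2Z^{(L)}(\kappa-\lambda)},$$ $$\widehat K_{00}^{(L)}(\lambda_1,\lambda_2)=\frac{Z^{(L)}_{0|1;0|1}(\lambda_2;\lambda_1)-Z^{(L)}_{0|1;0|1}(\lambda_1;\lambda_2)}{2Z^{(L+1)}},$$ $$\widehat K_{1}^{(L)}(\kappa)=\frac{Z^{(L)}_{0|0;1|0}(\kappa)+Z^{(L)}_{1|0;0|0}(\kappa)}{2Z^{(L)}},\qquad \widehat K_{0}^{(L)}(\lambda)=\frac{Z^{(L)}_{0|0;0|1}(\lambda)-Z^{(L)}_{0|1;0|0}(\lambda)}{2Z^{(L+1)}}.$$ **Proposition.** Let $N,k,l\ge 0$ be integers with $N+l-k>1$, let $\kappa_1,\dots,\kappa_k\in\mathbb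 C\setminus[0,\infty)$ and $\lambda_1,\dots,\lambda_l\in\mathbb C$ be pairwise different. Put $L=N+l-k$ if $k+l$ is even and $L=N+l-k+1$ if $k+l$ is odd, and let $\alpha$ be such that $x\mapsto x^n\alpha(x)$ is integrable on $\mathbb R_+$ for $0\le n<L$ and $Z^{(L)}\ne0$. If $k+l$ is even, then $$Z^{(N)}_{k|l;k|l}(\kappa,\lambda;\kappa,\lambda)=\frac{Z^{(L)}}{B_{k|l}^2(\kappa;\lambda)}\det\begin{bmatrix}\widehat K_{11}^{(L+1)}(\kappa_i,\kappa_j)&-\widehat K_{01}^{(L)}(\kappa_i,\lambda_j)\\ \widehat K_{01}^{(L)}(\kappa_j,\lambda_i)&\widehat K_{00}^{(L-1)}(\lambda_i,\lambda_j)\end{bmatrix}.$$ If $k+l$ is odd, then $$Z^{(N)}_{k|l;k|l}(\kappa,\lambda;\kappa,\lambda)=\frac{Z^{(L)}}{B_{k|l}^2(\kappa;\lambda)}\det\begin{bmatrix}\widehat K_{11}^{(L+1)}(\kappa_i,\kappa_j)&-\widehat K_{01}^{(L)}(\kappa_i,\lambda_j)&-\widehat K_1^{(L)}(\kappa_i)\\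 \widehat K_{01}^{(L)}(\kappa_j,\lambda_i)&\widehat K_{00}^{(L-1)}(\lambda_i,\lambda_j)&\widehat K_0^{(L-1)}(\lambda_i)\\ \widehat K_1^{(L)}(\kappa_j)&-\widehat K_0^{(L-1)}(\lambda_j)&0\end{bmatrix}.$$ In both formulas $1\le i,j\le k$ in the first block of rows and columns and $1\le i,j\le l$ in the second one. -/

import Mathlib

open MeasureTheory

/-- The Vandermonde product `Δ_n(u) = ∏_{i < j} (u_j - u_i)`. -/
def vandermondeProd {R : Type*} [CommRing R] {n : ℕ} (u : Fin n → R) : R :=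
  ∏ i, ∏ j ∈ Finset.Ioi i, (u j - u i)

/-- The mixed Cauchy-Vandermonde product
`B_{k|l}(κ; λ) = Δ_k(κ) Δ_l(λ) / ∏_{i,j} (κ_i - λ_j)`. -/
noncomputable def mixedCauchyVandermonde {k l : ℕ} (kap : Fin k → ℂ) (lam : Fin l → ℂ) : ℂ :=
  vandermondeProd kap * vandermondeProd lam / ∏ i, ∏ j, (kap i - lam j)

/-- Lebesgue measure on `ℝ₊^N`, where `ℝ₊ = (0, ∞)`. -/
noncomputable def positiveLebesgue (N : ℕ) : Measure (Fin N → ℝ) :=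
  Measure.pi fun _ => volume.restrict (Set.Ioi 0)

/-- The one-variable factor `∏_i (x - λ_i) / ∏_i (x - κ_i)`. -/
noncomputable def charRatio {k l : ℕ} (kap : Fin k → ℂ) (lam : Fin l → ℂ) (x : ℝ) : ℂ :=
  (∏ i, ((x : ℂ) - lam i)) / ∏ i, ((x : ℂ) - kap i)

/-- The partition function `Z^{(N,C)}_{k₁|l₁;k₂|l₂}[α](κ₁, λ₁; κ₂, λ₂)` of the Cauchy-like
two-matrix model with one-point weight `α`. -/
noncomputable def cauchyPartition (α : ℝ → ℂ) (N : ℕ) {k₁ l₁ k₂ l₂ : ℕ}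
    (kap₁ : Fin k₁ → ℂ) (lam₁ : Fin l₁ → ℂ) (kap₂ : Fin k₂ → ℂ) (lam₂ : Fin l₂ → ℂ) : ℂ :=
  1 / ((N.factorial : ℂ) ^ 2) *
    ∫ p : (Fin N → ℝ) × (Fin N → ℝ),
      ((vandermondeProd p.1 ^ 2 * vandermondeProd p.2 ^ 2 /
          ∏ i, ∏ j, (p.1 i + p.2 j) : ℝ) : ℂ) *
        ∏ j, (α (p.1 j) * α (p.2 j) * (p.2 j : ℂ) *
          (charRatio kap₁ lam₁ (p.1 j) * charRatio kap₂ lam₂ (p.2 j)))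
      ∂((positiveLebesgue N).prod (positiveLebesgue N))

/-- The normalization `Z^{(N,C)}_{0|0;0|0}[α]`. -/
noncomputable def cauchyNormalization (α : ℝ → ℂ) (N : ℕ) : ℂ :=
  cauchyPartition α N ![] ![] ![] ![]

/-- The kernel `K̂₁₁^{(L)}(κ₁, κ₂)`. -/
noncomputable def kernel11 (α : ℝ → ℂ) (L : ℕ) (kap₁ kap₂ : ℂ) : ℂ :=
  (cauchyPartition α L ![kap₁] ![] ![kap₂] ![] - cauchyPartition α L ![kap₂] ![] ![kap₁] ![]) /
    (2 * cauchyNormalization α (L - 1))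

/-- The kernel `K̂₀₁^{(L)}(κ, λ)`. -/
noncomputable def kernel01 (α : ℝ → ℂ) (L : ℕ) (kap lam : ℂ) : ℂ :=
  (cauchyPartition α L ![] ![] ![kap] ![lam] + cauchyPartition α L ![kap] ![lam] ![] ![]) /
    (2 * cauchyNormalization α L * (kap - lam))

/-- The kernel `K̂₀₀^{(L)}(λ₁, λ₂)`. -/
noncomputable def kernel00 (α : ℝ → ℂ) (L : ℕ) (lam₁ lam₂ : ℂ) : ℂ :=
  (cauchyPartition α L ![] ![lam₂] ![] ![lam₁] - cauchyPartition α L ![] ![lam₁] ![] ![lam₂]) /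
    (2 * cauchyNormalization α (L + 1))

/-- The kernel `K̂₁^{(L)}(κ)`. -/
noncomputable def kernel1 (α : ℝ → ℂ) (L : ℕ) (kap : ℂ) : ℂ :=
  (cauchyPartition α L ![] ![] ![kap] ![] + cauchyPartition α L ![kap] ![] ![] ![]) /
    (2 * cauchyNormalization α L)

/-- The kernel `K̂₀^{(L)}(λ)`. -/
noncomputable def kernel0 (α : ℝ → ℂ) (L : ℕ) (lam : ℂ) : ℂ :=
  (cauchyPartition α L ![] ![] ![] ![lam] - cauchyPartition α L ![] ![lam] ![] ![]) /
    (2 * cauchyNormalization α (L + 1))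

/-- The antisymmetric matrix with blocks
`[K̂₁₁^{(L+1)}(κ_i, κ_j), -K̂₀₁^{(L)}(κ_i, λ_j); K̂₀₁^{(L)}(κ_j, λ_i), K̂₀₀^{(L-1)}(λ_i, λ_j)]`. -/
noncomputable def kernelMatrixEven (α : ℝ → ℂ) (L : ℕ) {k l : ℕ}
    (kap : Fin k → ℂ) (lam : Fin l → ℂ) : Matrix (Fin k ⊕ Fin l) (Fin k ⊕ Fin l) ℂ :=
  Matrix.fromBlocks
    (Matrix.of fun i j => kernel11 α (L + 1) (kap i) (kap j))
    (Matrix.of fun i j => -kernel01 α L (kap i) (lam j))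
    (Matrix.of fun i j => kernel01 α L (kap j) (lam i))
    (Matrix.of fun i j => kernel00 α (L - 1) (lam i) (lam j))

/-- The antisymmetric matrix `kernelMatrixEven` bordered by the last column
`(-K̂₁^{(L)}(κ_i), K̂₀^{(L-1)}(λ_i), 0)` and the last row
`(K̂₁^{(L)}(κ_j), -K̂₀^{(L-1)}(λ_j), 0)`. -/
noncomputable def kernelMatrixOdd (α : ℝ → ℂ) (L : ℕ) {k l : ℕ}
    (kap : Fin k → ℂ) (lam : Fin l → ℂ) :
    Matrix ((Fin k ⊕ Fin l) ⊕ Unit) ((Fin k ⊕ Fin l) ⊕ Unit) ℂ :=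
  Matrix.fromBlocks
    (kernelMatrixEven α L kap lam)
    (Matrix.of fun i _ =>
      Sum.elim (fun a => -kernel1 α L (kap a)) (fun b => kernel0 α (L - 1) (lam b)) i)
    (Matrix.of fun _ j =>
      Sum.elim (fun a => kernel1 α L (kap a)) (fun b => -kernel0 α (L - 1) (lam b)) j)
    0

/-!
Expanding the Cauchy determinant and integrating it against the remaining factors by Andréief's
identity turns `Z^{(N)}` into a Gram determinant for the pairing `∬ f(x) g(y) y / (x + y) dx dy`.
Since `y / (x + y) + x / (x + y) = 1`, the symmetric part of this pairing has rank one.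

Put `Q = ∏ᵢ (X - κᵢ)` and absorb `1 / Q` into the weight. The products `Q X ^ a` with `a < L` and
the quotients `Q / (X - κᵢ)` together span the polynomials of degree less than `k + L`. The `λⱼ`
enter by bordering the pairing antisymmetrically with the functionals `p ↦ p(λⱼ) / Q(λⱼ)`, joined
when `k + l` is odd by the leading coefficient, so that the border always has even size. Projecting
the border orthogonally to the `Q X ^ a` splits off `Z^{(L)}` and leaves a pairing whose symmetric
part still has rank one. A matrix of even size with symmetric part of rank one has the determinant
of its antisymmetric part, and the entries of this antisymmetric part are the kernels.
-/

open Matrix Polynomial Finset Lagrange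
open LinearMap (BilinForm)

section CauchyDeterminant

variable {K : Type*} [Field K] {n : ℕ}

theorem det_eval_eq_det_coeff_mul_vandermondeProd {R : Type*} [CommRing R] {p : Fin n → R[X]}
    (hp : ∀ i, (p i).natDegree < n) (y : Fin n → R) :
    (of fun i j => (p i).eval (y j)).det =
      (of fun i b : Fin n => (p i).coeff b).det * vandermondeProd y := by
  rw [vandermondeProd, ← det_vandermonde, ← det_transpose (vandermonde y), ← det_mul]
  congr 1
  ext i j
  simp only [of_apply, mul_apply, transpose_apply, vandermonde_apply]
  rw [eval_eq_sum_range' (hp i), sum_range]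

theorem natDegree_nodal_erase (u : Fin n → K) (i : Fin n) :
    (nodal (univ.erase i) u).natDegree = n - 1 := by
  rw [natDegree_nodal, card_erase_of_mem (mem_univ i), card_fin]

theorem natDegree_nodal_erase_lt (u : Fin n → K) (i : Fin n) :
    (nodal (univ.erase i) u).natDegree < n := by
  rw [natDegree_nodal_erase]
  exact Nat.sub_one_lt_of_lt i.isLt

theorem vandermondeProd_ne_zero {u : Fin n → K} (hu : Function.Injective u) :
    vandermondeProd u ≠ 0 := by
  rw [vandermondeProd, ← det_vandermonde]
  exact det_vandermonde_ne_zero_iff.2 hu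

theorem vandermondeProd_neg_sq {R : Type*} [CommRing R] (u : Fin n → R) :
    vandermondeProd (-u) ^ 2 = vandermondeProd u ^ 2 := by
  simp only [vandermondeProd, ← prod_pow]
  refine prod_congr rfl fun i _ => prod_congr rfl fun j _ => ?_
  simp only [Pi.neg_apply]
  ring

theorem prod_eval_nodal_erase (u : Fin n → K) :
    ∏ i, (nodal (univ.erase i) u).eval (u i) = vandermondeProd u * vandermondeProd (-u) := by
  simp only [eval_nodal, vandermondeProd, ← prod_mul_distrib, Pi.neg_apply, neg_sub_neg,
    prod_prod_Ioi_mul_eq_prod_prod_off_diag fun j i => u j - u i]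
  rw [prod_sigma', prod_sigma']
  exact prod_nbij' (fun a => ⟨a.2, a.1⟩) (fun a => ⟨a.2, a.1⟩) (by simp [eq_comm])
    (by simp [eq_comm]) (by simp) (by simp) (by simp)

theorem det_coeff_nodal_erase {u : Fin n → K} (hu : Function.Injective u) :
    (of fun i b : Fin n => (nodal (univ.erase i) u).coeff b).det = vandermondeProd (-u) := by
  refine mul_right_cancel₀ (vandermondeProd_ne_zero hu) ?_
  rw [← det_eval_eq_det_coeff_mul_vandermondeProd (natDegree_nodal_erase_lt u),
    mul_comm (vandermondeProd _), ← prod_eval_nodal_erase, ← det_diagonal]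
  congr 1
  ext i j
  rcases eq_or_ne i j with rfl | hij
  · simp
  · rw [diagonal_apply_ne _ hij, of_apply]
    exact eval_nodal_at_node (mem_erase.2 ⟨hij.symm, mem_univ j⟩)

theorem det_cauchy (x y : Fin n → K) (h : ∀ i j, x i + y j ≠ 0) :
    (of fun i j => (x i + y j)⁻¹).det =
      vandermondeProd x * vandermondeProd y / ∏ i, ∏ j, (x i + y j) := by
  have hne : ∏ i, ∏ j, (x i + y j) ≠ 0 :=
    prod_ne_zero_iff.2 fun i _ => prod_ne_zero_iff.2 fun j _ => h i j
  by_cases hx : Function.Injective x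
  · have hcoeff := det_coeff_nodal_erase (neg_injective.comp hx)
    rw [show -(Neg.neg ∘ x) = x from neg_neg x] at hcoeff
    rw [eq_div_iff hne, mul_comm, prod_comm, ← det_mul_row, ← hcoeff,
      ← det_eval_eq_det_coeff_mul_vandermondeProd (natDegree_nodal_erase_lt _)]
    congr 1
    ext i j
    simp only [of_apply, eval_nodal, Function.comp_apply, sub_neg_eq_add]
    rw [← mul_prod_erase _ _ (mem_univ i), mul_comm, inv_mul_cancel_left₀ (h i j)]
    exact prod_congr rfl fun m _ => add_comm _ _
  · obtain ⟨i, j, hij, hne'⟩ := Function.not_injective_iff.1 hx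
    rw [vandermondeProd, ← det_vandermonde, det_vandermonde_eq_zero_iff.2 ⟨i, j, hij, hne'⟩,
      zero_mul, zero_div]
    exact det_zero_of_row_eq hne' (by ext m; simp [hij])

end CauchyDeterminant

section RankOneSymmetricPart

variable {K τ : Type*} [Field K] [NeZero (2 : K)] [Fintype τ] [DecidableEq τ]

theorem det_eq_zero_of_transpose_eq_neg {A : Matrix τ τ K} (hA : Aᵀ = -A)
    (hodd : Odd (Fintype.card τ)) : A.det = 0 := by
  have hneg : A.det = -A.det := by
    rw [← neg_one_mul, ← hodd.neg_one_pow, ← det_neg, ← hA, det_transpose]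
  have hdouble : 2 * A.det = 0 := by linear_combination hneg
  exact (mul_eq_zero.1 hdouble).resolve_left two_ne_zero

theorem det_add_vecMulVec_of_transpose_eq_neg {A : Matrix τ τ K} (hA : Aᵀ = -A)
    (heven : Even (Fintype.card τ)) (v : τ → K) : (A + vecMulVec v v).det = A.det := by
  -- Bordering `A` by `v` and `-v` with corner `0` gives an antisymmetric matrix of odd size, so
  -- raising the corner to `1` contributes all of the determinant.
  let borderedBy (r : τ ⊕ Unit → K) : Matrix (τ ⊕ Unit) (τ ⊕ Unit) K :=
    updateRow (fromBlocks A (replicateCol Unit v) 0 0) (Sum.inr ()) r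
  have hborder (t : τ → K) (c : K) : borderedBy (Sum.elim t fun _ => c) =
      fromBlocks A (replicateCol Unit v) (replicateRow Unit t) (c • 1) := by
    ext (i | i) (j | j) <;> simp [borderedBy, updateRow_apply]
  have hskew : (borderedBy (Sum.elim (-v) fun _ => 0)).det = 0 := by
    refine det_eq_zero_of_transpose_eq_neg ?_ (by simpa using heven.add_one)
    rw [hborder, fromBlocks_transpose, hA]
    ext (i | i) (j | j) <;> simp
  calc (A + vecMulVec v v).det
      = (borderedBy (Sum.elim (-v) fun _ => 1)).det := by
        rw [hborder, one_smul, det_fromBlocks_one₂₂, vecMulVec_eq Unit, ← sub_neg_eq_add,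
          ← Matrix.mul_neg]
        rfl
    _ = (borderedBy (Sum.elim (-v) fun _ => 0)).det + (borderedBy (Sum.elim 0 fun _ => 1)).det := by
        rw [← det_updateRow_add, ← Sum.elim_add_add]
        simp [borderedBy, Pi.add_def]
    _ = A.det := by
        rw [hskew, zero_add, hborder]
        simp

theorem det_eq_det_skew_part_of_add_transpose_eq_vecMulVec {S : Matrix τ τ K} {v : τ → K}
    (hS : S + Sᵀ = vecMulVec v v) (heven : Even (Fintype.card τ)) :
    S.det = (of fun s t => (S s t - S t s) / 2).det := by
  have hskew : (S - Sᵀ)ᵀ = -(S - Sᵀ) := by simp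
  have htwo : (2 : K) • S = S - Sᵀ + vecMulVec v v := by
    rw [← hS, two_smul]
    abel
  have hdet : (2 : K) ^ Fintype.card τ * S.det = (S - Sᵀ).det := by
    rw [← det_smul, htwo, det_add_vecMulVec_of_transpose_eq_neg hskew heven]
  have hpart : (of fun s t => (S s t - S t s) / 2) = (2 : K)⁻¹ • (S - Sᵀ) := by
    ext s t
    simp [div_eq_inv_mul]
  rw [hpart, det_smul, ← hdet, inv_pow, inv_mul_cancel_left₀ (pow_ne_zero _ two_ne_zero)]

end RankOneSymmetricPart

section Gram

variable {R V ι τ : Type*} [AddCommGroup V]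

section CommRing

variable [CommRing R] [Module R V] [Fintype ι] [DecidableEq ι] [Fintype τ] [DecidableEq τ]

/-- The Gram matrix of two families of vectors with respect to a bilinear form, which need not be
symmetric: `f` indexes the rows and `g` the columns. -/
def gramMatrix {κ : Type*} (B : BilinForm R V) (f : τ → V) (g : κ → V) : Matrix τ κ R :=
  of fun i j => B (f i) (g j)

theorem det_gramMatrix_flip (B : BilinForm R V) (f g : τ → V) :
    (gramMatrix B.flip f g).det = (gramMatrix B g f).det :=
  det_transpose (gramMatrix B g f)

theorem det_gramMatrix_comp_equiv (B : BilinForm R V) (f g : τ → V) (e : ι ≃ τ) :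
    (gramMatrix B (f ∘ e) (g ∘ e)).det = (gramMatrix B f g).det :=
  det_submatrix_equiv_self e (gramMatrix B f g)

/-- The Gram determinant of the family `f` enlarged by `x` in the rows and by `y` in the
columns. -/
def borderedGramDet (B : BilinForm R V) (f : ι → V) (x y : V) : R :=
  (gramMatrix B (Sum.elim f fun _ : Fin 1 => x) (Sum.elim f fun _ => y)).det

theorem borderedGramDet_flip (B : BilinForm R V) (f : ι → V) (x y : V) :
    borderedGramDet B.flip f x y = borderedGramDet B f y x :=
  det_gramMatrix_flip B _ _

theorem borderedGramDet_comp_equiv {κ : Type*} [Fintype κ] [DecidableEq κ] (B : BilinForm R V)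
    (f : ι → V) (e : κ ≃ ι) (x y : V) :
    borderedGramDet B (f ∘ e) x y = borderedGramDet B f x y := by
  rw [borderedGramDet, borderedGramDet,
    ← det_gramMatrix_comp_equiv B _ _ (Equiv.sumCongr e (Equiv.refl (Fin 1)))]
  congr 2 <;> ext (a | a) <;> rfl

/-- The projection of `x` along the span of `f` onto its left orthogonal complement. It depends on
`B` being nondegenerate on that span: otherwise the inverse below is `0` and so is the
correction. -/
noncomputable def gramResidual (B : BilinForm R V) (f : ι → V) (x : V) : V :=
  x - ∑ a, ((fun b => B x (f b)) ᵥ* (gramMatrix B f f)⁻¹) a • f a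

theorem gramResidual_left_apply (B : BilinForm R V) (f : ι → V) (x y : V) :
    B (gramResidual B f x) y =
      B x y - (((fun b => B x (f b)) ᵥ* (gramMatrix B f f)⁻¹) ⬝ᵥ fun a => B (f a) y) := by
  simp [gramResidual, dotProduct]

theorem gramResidual_left_orthogonal {B : BilinForm R V} {f : ι → V}
    (hdet : IsUnit (gramMatrix B f f).det) (x : V) (a : ι) : B (gramResidual B f x) (f a) = 0 := by
  have hcancel := congrFun (vecMul_vecMul (fun b => B x (f b)) (gramMatrix B f f)⁻¹
    (gramMatrix B f f)) a
  rw [nonsing_inv_mul _ hdet, vecMul_one] at hcancel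
  rw [gramResidual_left_apply, sub_eq_zero]
  exact hcancel.symm

theorem gramResidual_right_apply {B : BilinForm R V} {f : ι → V}
    (hdet : IsUnit (gramMatrix B f f).det) (x y : V) :
    B (gramResidual B f x) (gramResidual B f y) = B (gramResidual B f x) y := by
  conv_lhs => rw [gramResidual.eq_1 B f y]
  simp [gramResidual_left_orthogonal hdet]

theorem det_gramMatrix_sumElim {B : BilinForm R V} {f : ι → V}
    (hdet : IsUnit (gramMatrix B f f).det) (g h : τ → V) :
    (gramMatrix B (Sum.elim f g) (Sum.elim f h)).det =
      (gramMatrix B f f).det * (gramMatrix B (gramResidual B f ∘ g) h).det := by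
  let := (gramMatrix B f f).invertibleOfIsUnitDet hdet
  have hblocks : gramMatrix B (Sum.elim f g) (Sum.elim f h) =
      fromBlocks (gramMatrix B f f) (gramMatrix B f h) (gramMatrix B g f) (gramMatrix B g h) := by
    ext (i | i) (j | j) <;> rfl
  rw [hblocks, det_fromBlocks₁₁, invOf_eq_nonsing_inv]
  congr 2
  ext s t
  exact (gramResidual_left_apply B f (g s) (h t)).symm

end CommRing

section SkewGramRatio

variable [Field R] [Module R V] [Fintype ι] [DecidableEq ι] [Fintype τ] [DecidableEq τ]

/-- The antisymmetric part of the form induced by `B` on the left orthogonal complement of the span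
of `f`, expressed as a ratio of Gram determinants. These ratios become the kernels. -/
noncomputable def skewGramRatio (B : BilinForm R V) (f : ι → V) (x y : V) : R :=
  (borderedGramDet B f x y - borderedGramDet B f y x) / (2 * (gramMatrix B f f).det)

theorem skewGramRatio_swap (B : BilinForm R V) (f : ι → V) (x y : V) :
    skewGramRatio B f y x = -skewGramRatio B f x y := by
  rw [skewGramRatio, skewGramRatio, ← neg_div, neg_sub]

theorem skewGramRatio_self (B : BilinForm R V) (f : ι → V) (x : V) : skewGramRatio B f x x = 0 := by
  rw [skewGramRatio, sub_self, zero_div]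

theorem borderedGramDet_eq_mul {B : BilinForm R V} {f : ι → V} (hdet : (gramMatrix B f f).det ≠ 0)
    (x y : V) :
    borderedGramDet B f x y = (gramMatrix B f f).det * B (gramResidual B f x) y := by
  rw [borderedGramDet, det_gramMatrix_sumElim hdet.isUnit]
  exact congrArg _ (det_unique _)

theorem det_gramMatrix_sumElim_eq_det_skewGramRatio [NeZero (2 : R)] {B : BilinForm R V} {w : V → R}
    (hB : ∀ x y, B x y + B y x = w x * w y) {f : ι → V} (hdet : (gramMatrix B f f).det ≠ 0)
    (heven : Even (Fintype.card τ)) (g : τ → V) :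
    (gramMatrix B (Sum.elim f g) (Sum.elim f g)).det =
      (gramMatrix B f f).det * (of fun s t => skewGramRatio B f (g s) (g t)).det := by
  have hsymm : gramMatrix B (gramResidual B f ∘ g) g + (gramMatrix B (gramResidual B f ∘ g) g)ᵀ =
      vecMulVec (w ∘ gramResidual B f ∘ g) (w ∘ gramResidual B f ∘ g) := by
    ext s t
    simp only [Matrix.add_apply, transpose_apply, gramMatrix, of_apply, Function.comp_apply,
      vecMulVec_apply, ← hB, gramResidual_right_apply hdet.isUnit]
  rw [det_gramMatrix_sumElim hdet.isUnit, det_eq_det_skew_part_of_add_transpose_eq_vecMulVec hsymm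
    heven]
  congr 2
  ext s t
  simp only [of_apply, skewGramRatio, borderedGramDet_eq_mul hdet, ← mul_sub]
  rw [mul_comm 2, mul_div_mul_left _ _ hdet]
  rfl

end SkewGramRatio

end Gram

section TransitionDeterminant

variable {R V W ι τ : Type*} [CommRing R] [AddCommGroup V] [Module R V] [AddCommGroup W]
  [Module R W] [Fintype ι] [DecidableEq ι] [Fintype τ] [DecidableEq τ]

/-- The family `f` is expressed through the family `f'` by a square matrix of determinant `d`. Only
the determinant is recorded, since Gram determinants depend on nothing else. -/
def HasTransitionDet (f f' : τ → V) (d : R) : Prop :=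
  ∃ M : Matrix τ τ R, M.det = d ∧ ∀ i, f i = ∑ a, M i a • f' a

namespace HasTransitionDet

variable {f f' f'' : τ → V} {d d' : R}

theorem det_gramMatrix_left (h : HasTransitionDet f f' d) (B : BilinForm R V) (g : τ → V) :
    (gramMatrix B f g).det = d * (gramMatrix B f' g).det := by
  obtain ⟨M, rfl, hM⟩ := h
  rw [funext hM, ← det_mul]
  congr 1
  ext i j
  simp [gramMatrix, mul_apply]

theorem det_gramMatrix_right (h : HasTransitionDet f f' d) (B : BilinForm R V) (g : τ → V) :
    (gramMatrix B g f).det = d * (gramMatrix B g f').det := by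
  rw [← det_gramMatrix_flip, h.det_gramMatrix_left, det_gramMatrix_flip]

theorem refl (f : τ → V) : HasTransitionDet f f (1 : R) :=
  ⟨1, det_one, fun i => by simp [one_apply]⟩

theorem trans (h : HasTransitionDet f f' d) (h' : HasTransitionDet f' f'' d') :
    HasTransitionDet f f'' (d * d') := by
  obtain ⟨M, rfl, hM⟩ := h
  obtain ⟨M', rfl, hM'⟩ := h'
  refine ⟨M * M', det_mul _ _, fun i => ?_⟩
  simp only [hM, hM', smul_sum, mul_apply, sum_smul, mul_smul]
  exact sum_comm

theorem symm (h : HasTransitionDet f f' d) (hd : IsUnit d) :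
    HasTransitionDet f' f (Ring.inverse d) := by
  obtain ⟨M, rfl, hM⟩ := h
  refine ⟨M⁻¹, det_nonsing_inv M, fun i => ?_⟩
  simp only [hM, smul_sum, smul_smul]
  rw [sum_comm]
  simp [← sum_smul, ← mul_apply, nonsing_inv_mul _ hd, one_apply]

theorem map (h : HasTransitionDet f f' d) (A : V →ₗ[R] W) :
    HasTransitionDet (A ∘ f) (A ∘ f') d := by
  obtain ⟨M, hd, hM⟩ := h
  exact ⟨M, hd, fun i => by simp [hM]⟩

theorem sumElim_left (h : HasTransitionDet f f' d) (g : ι → V) :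
    HasTransitionDet (Sum.elim f g) (Sum.elim f' g) d := by
  obtain ⟨M, rfl, hM⟩ := h
  refine ⟨fromBlocks M 0 0 1, by simp, ?_⟩
  rintro (i | j) <;> simp [hM, one_apply]

theorem sumElim_right (h : HasTransitionDet f f' d) (g : ι → V) :
    HasTransitionDet (Sum.elim g f) (Sum.elim g f') d := by
  obtain ⟨M, rfl, hM⟩ := h
  refine ⟨fromBlocks 1 0 0 M, by simp, ?_⟩
  rintro (i | j) <;> simp [hM, one_apply]

end HasTransitionDet

theorem hasTransitionDet_comp_perm (f : τ → V) (σ : Equiv.Perm τ) :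
    HasTransitionDet (f ∘ σ) f (Equiv.Perm.sign σ : R) := by
  refine ⟨σ.permMatrix R, det_permutation σ, fun i => ?_⟩
  simp [Equiv.Perm.permMatrix, PEquiv.toMatrix_apply]

theorem hasTransitionDet_X_pow_coeff {n : ℕ} {u : τ → R[X]} (e : τ ≃ Fin n)
    (hu : ∀ s, (u s).natDegree < n) :
    HasTransitionDet u (fun s => X ^ (e s : ℕ)) (of fun s t => (u s).coeff (e t)).det := by
  refine ⟨_, rfl, fun s => ?_⟩
  conv_lhs => rw [(u s).as_sum_range' n (hu s), sum_range, ← e.sum_comp]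
  simp [smul_X_eq_monomial]

theorem hasTransitionDet_X_pow_of_monic {n : ℕ} {u : τ → R[X]} (e : τ ≃ Fin n)
    (hu : ∀ s, (u s).Monic) (hdeg : ∀ s, (u s).natDegree = e s) :
    HasTransitionDet u (fun s => X ^ (e s : ℕ)) (1 : R) := by
  have hdet := det_matrixOfPolynomials (u ∘ e.symm) (fun a => by simp [hdeg]) fun a => hu _
  convert hasTransitionDet_X_pow_coeff e fun s => (hdeg s).trans_lt (e s).isLt
  rw [← hdet, ← det_submatrix_equiv_self e, ← det_transpose]
  congr 1
  ext s t
  simp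

theorem hasTransitionDet_of_monic {n : ℕ} {u u' : τ → R[X]} (e e' : τ ≃ Fin n)
    (hu : ∀ s, (u s).Monic) (hdeg : ∀ s, (u s).natDegree = e s)
    (hu' : ∀ s, (u' s).Monic) (hdeg' : ∀ s, (u' s).natDegree = e' s) :
    HasTransitionDet u u' (Equiv.Perm.sign (e.trans e'.symm) : R) := by
  have hperm := hasTransitionDet_comp_perm (R := R) (fun s => (X : R[X]) ^ (e' s : ℕ))
    (e.trans e'.symm)
  have hcomp : (fun s => (X : R[X]) ^ (e' s : ℕ)) ∘ (e.trans e'.symm) =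
      fun s => (X : R[X]) ^ (e s : ℕ) := by
    ext1 s
    simp
  rw [hcomp] at hperm
  simpa using ((hasTransitionDet_X_pow_of_monic e hu hdeg).trans hperm).trans
    ((hasTransitionDet_X_pow_of_monic e' hu' hdeg').symm isUnit_one)

theorem hasTransitionDet_nodal_erase {K : Type*} [Field K] {k : ℕ} {u : Fin k → K}
    (hu : Function.Injective u) :
    HasTransitionDet (fun i => nodal (univ.erase i) u) (fun b : Fin k => X ^ (b : ℕ))
      (vandermondeProd (-u)) := by
  rw [← det_coeff_nodal_erase hu]
  exact hasTransitionDet_X_pow_coeff (Equiv.refl _) (natDegree_nodal_erase_lt u)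

end TransitionDeterminant

section BorderedForm

variable {R V J ν σ : Type*} [CommRing R] [AddCommGroup V] [Module R V] [Fintype J]

/-- The extension of `β` to `V × (J → R)` by the antisymmetric pairing of the functionals `φ j` on
`V` with the coordinates of `J → R`. Its symmetric part is that of `β`. -/
def borderedForm (β : BilinForm R V) (φ : J → V →ₗ[R] R) : BilinForm R (V × (J → R)) :=
  β.compl₁₂ (.fst R V (J → R)) (.fst R V (J → R)) +
    (dotProductBilin R R).compl₁₂ (.pi φ ∘ₗ .fst R V (J → R)) (.snd R V (J → R)) -
    (dotProductBilin R R).compl₁₂ (.snd R V (J → R)) (.pi φ ∘ₗ .fst R V (J → R))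

theorem borderedForm_apply (β : BilinForm R V) (φ : J → V →ₗ[R] R) (x y : V × (J → R)) :
    borderedForm β φ x y =
      β x.1 y.1 + ((fun j => φ j x.1) ⬝ᵥ y.2) - (x.2 ⬝ᵥ fun j => φ j y.1) := rfl

theorem borderedForm_inl_inl (β : BilinForm R V) (φ : J → V →ₗ[R] R) (p q : V) :
    borderedForm β φ (p, 0) (q, 0) = β p q := by
  simp [borderedForm_apply]

theorem borderedForm_add_swap {β : BilinForm R V} {w : V → R}
    (hβ : ∀ p q, β p q + β q p = w p * w q) (φ : J → V →ₗ[R] R) (x y : V × (J → R)) :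
    borderedForm β φ x y + borderedForm β φ y x = w x.1 * w y.1 := by
  rw [← hβ, borderedForm_apply, borderedForm_apply, dotProduct_comm x.2, dotProduct_comm y.2]
  ring

theorem gramMatrix_borderedForm_inl (β : BilinForm R V) (φ : J → V →ₗ[R] R) (p q : ν → V) :
    gramMatrix (borderedForm β φ) (LinearMap.inl R V (J → R) ∘ p) (LinearMap.inl R V (J → R) ∘ q) =
      gramMatrix β p q := by
  ext i j
  exact borderedForm_inl_inl β φ (p i) (q j)

theorem borderedForm_flip (β : BilinForm R V) (φ : J → V →ₗ[R] R) :
    (borderedForm β φ).flip = borderedForm β.flip (-φ) := by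
  refine LinearMap.ext₂ fun x y => ?_
  change borderedForm β φ y x =
    β y.1 x.1 + ((fun j => -φ j x.1) ⬝ᵥ y.2) - (x.2 ⬝ᵥ fun j => -φ j y.1)
  rw [borderedForm_apply, dotProduct_comm y.2, dotProduct_comm x.2, ← Pi.neg_def,
    ← Pi.neg_def, neg_dotProduct, neg_dotProduct]
  ring

variable [DecidableEq J] [Fintype ν] [DecidableEq ν] [Fintype σ] [DecidableEq σ]

variable (R V) in
/-- The vector that a bordered form pairs with the functional of index `j`. -/
def functionalVector (j : J) : V × (J → R) := (0, Pi.single j 1)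

theorem borderedForm_inl_functionalVector (β : BilinForm R V) (φ : J → V →ₗ[R] R) (p : V) (j : J) :
    borderedForm β φ (p, 0) (functionalVector R V j) = φ j p := by
  simp [borderedForm_apply, functionalVector]

theorem borderedForm_functionalVector_inl (β : BilinForm R V) (φ : J → V →ₗ[R] R) (p : V) (j : J) :
    borderedForm β φ (functionalVector R V j) (p, 0) = -φ j p := by
  simp [borderedForm_apply, functionalVector]

theorem borderedForm_functionalVector_functionalVector (β : BilinForm R V) (φ : J → V →ₗ[R] R)
    (i j : J) : borderedForm β φ (functionalVector R V i) (functionalVector R V j) = 0 := by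
  simp [borderedForm_apply, functionalVector]

theorem det_fromBlocks_corner (A : Matrix ν ν R) (B : Matrix ν σ R) (C : Matrix σ ν R)
    (D E F : Matrix σ σ R) :
    (fromBlocks (fromBlocks A B C D) (fromRows 0 E) (fromCols 0 (-F)) 0).det =
      A.det * E.det * F.det := by
  have hassoc : fromBlocks (fromBlocks A B C D) (fromRows 0 E) (fromCols 0 (-F)) 0 =
      (fromBlocks A (fromCols B 0) (fromRows C 0) (fromBlocks D E (-F) 0)).submatrix
        (Equiv.sumAssoc ν σ σ) (Equiv.sumAssoc ν σ σ) := by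
    ext ((i | i) | i) ((j | j) | j) <;> rfl
  have htriangular : fromBlocks A (fromCols B 0) (fromRows C 0) (fromBlocks D E (-F) 0) *
      fromBlocks 1 0 0 (J σ R) =
      (fromBlocks (fromBlocks A 0 C E) (fromRows (-B) (-D)) 0 F).submatrix
        (Equiv.sumAssoc ν σ σ).symm (Equiv.sumAssoc ν σ σ).symm := by
    rw [J, fromBlocks_multiply, fromBlocks_multiply, fromCols_mul_fromBlocks]
    ext (i | i | i) (j | j | j) <;> simp
  have hdet := congrArg det htriangular
  rw [det_mul, det_fromBlocks_zero₂₁, det_one,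
    SymplecticGroup.det_eq_one (SymplecticGroup.J_mem σ R), one_mul, mul_one,
    det_submatrix_equiv_self, det_fromBlocks_zero₂₁, det_fromBlocks_zero₁₂] at hdet
  rw [hassoc, det_submatrix_equiv_self, hdet]

theorem det_gramMatrix_borderedForm_left (β : BilinForm R V) (φ : J → V →ₗ[R] R) (p p' : ν → V)
    (c : σ → V) (t : σ → J) (hp : ∀ j a, φ (t j) (p a) = 0) :
    (gramMatrix (borderedForm β φ) (LinearMap.inl R V (J → R) ∘ Sum.elim p c)
        (Sum.elim (LinearMap.inl R V (J → R) ∘ p') (functionalVector R V ∘ t))).det =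
      (gramMatrix β p p').det * (of fun i j => φ (t j) (c i)).det := by
  rw [← det_fromBlocks_zero₁₂ _ (gramMatrix β c p')]
  congr 1
  ext (i | i) (j | j) <;>
    simp [gramMatrix, borderedForm_inl_inl, borderedForm_inl_functionalVector, hp]

theorem det_gramMatrix_borderedForm (β : BilinForm R V) (φ : J → V →ₗ[R] R) (p p' : ν → V)
    (c c' : σ → V) (s t : σ → J) (hp : ∀ j a, φ (t j) (p a) = 0)
    (hp' : ∀ i a, φ (s i) (p' a) = 0) :
    (gramMatrix (borderedForm β φ)
        (Sum.elim (LinearMap.inl R V (J → R) ∘ Sum.elim p c) (functionalVector R V ∘ s))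
        (Sum.elim (LinearMap.inl R V (J → R) ∘ Sum.elim p' c') (functionalVector R V ∘ t))).det =
      (gramMatrix β p p').det * (of fun i j => φ (t j) (c i)).det *
        (of fun i j => φ (s j) (c' i)).det := by
  rw [← det_transpose (of fun i j => φ (s j) (c' i)), ← det_fromBlocks_corner _ (gramMatrix β p c')
    (gramMatrix β c p') (gramMatrix β c c')]
  congr 1
  ext ((i | i) | i) ((j | j) | j) <;>
    simp [gramMatrix, borderedForm_inl_inl, borderedForm_inl_functionalVector,
      borderedForm_functionalVector_inl, borderedForm_functionalVector_functionalVector, hp, hp']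

end BorderedForm

section BorderedGramDeterminants

variable {R J : Type*} [CommRing R]

/-- The family `q, q X, …, q X ^ (n - 1)`. -/
noncomputable def powerMultiples (q : R[X]) (n : ℕ) (a : Fin n) : R[X] := q * X ^ (a : ℕ)

/-- The family `r, r X, …, r X ^ (n - 1), s`. -/
noncomputable def extendedMultiples (r s : R[X]) (n : ℕ) : Fin n ⊕ Fin 1 → R[X] :=
  Sum.elim (powerMultiples r n) fun _ => s

/-- The Gram determinant of `p, p X, …` against `q, q X, …` with `n` vectors each. -/
noncomputable def gramDet (β : BilinForm R R[X]) (p q : R[X]) (n : ℕ) : R :=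
  (gramMatrix β (powerMultiples p n) (powerMultiples q n)).det

theorem gramDet_flip (β : BilinForm R R[X]) (p q : R[X]) (n : ℕ) :
    gramDet β.flip p q n = gramDet β q p n :=
  det_gramMatrix_flip β _ _

theorem mulLeft_comp_powerMultiples (q r : R[X]) (n : ℕ) :
    LinearMap.mulLeft R q ∘ powerMultiples r n = powerMultiples (q * r) n := by
  ext1 a
  simp [powerMultiples, mul_assoc]

theorem mulLeft_comp_extendedMultiples (q r s : R[X]) (n : ℕ) :
    LinearMap.mulLeft R q ∘ extendedMultiples r s n = extendedMultiples (q * r) (q * s) n := by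
  rw [extendedMultiples, Sum.comp_elim, mulLeft_comp_powerMultiples]
  rfl

theorem monic_powerMultiples {q : R[X]} (hq : q.Monic) (n : ℕ) (a : Fin n) :
    (powerMultiples q n a).Monic :=
  hq.mul (monic_X_pow _)

theorem powerMultiples_one_comp_finSumFinEquiv (n : ℕ) :
    powerMultiples (1 : R[X]) (n + 1) ∘ finSumFinEquiv = extendedMultiples 1 (X ^ n) n := by
  ext1 (a | a) <;> simp [powerMultiples, extendedMultiples]

/-- The enumeration of `Fin (n + 1)` that puts `0` last. -/
def zeroLastEquiv (n : ℕ) : Fin n ⊕ Fin 1 ≃ Fin (n + 1) :=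
  finSumFinEquiv.trans (finRotate (n + 1))

theorem val_zeroLastEquiv_inl (n : ℕ) (a : Fin n) :
    (zeroLastEquiv n (Sum.inl a) : ℕ) = a + 1 := by
  simp only [zeroLastEquiv, Equiv.trans_apply, finSumFinEquiv_apply_left]
  exact coe_finRotate_of_ne_last (Fin.castSucc_lt_last a).ne

theorem zeroLastEquiv_inr (n : ℕ) (a : Fin 1) : zeroLastEquiv n (Sum.inr a) = 0 := by
  rw [Subsingleton.elim a 0]
  exact finRotate_last

theorem sign_zeroLastEquiv (n : ℕ) :
    Equiv.Perm.sign ((zeroLastEquiv n).trans finSumFinEquiv.symm) = (-1) ^ n := by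
  rw [zeroLastEquiv, Equiv.Perm.sign_trans_trans_symm, sign_finRotate, Nat.add_sub_cancel]

theorem monic_extendedMultiples {r s : R[X]} (hr : r.Monic) (hs : s.Monic) (n : ℕ)
    (i : Fin n ⊕ Fin 1) : (extendedMultiples r s n i).Monic := by
  rcases i with a | _
  · exact monic_powerMultiples hr n a
  · exact hs

section Nontrivial

variable [Nontrivial R]

theorem natDegree_powerMultiples {q : R[X]} (hq : q.Monic) (n : ℕ) (a : Fin n) :
    (powerMultiples q n a).natDegree = q.natDegree + a := by
  rw [powerMultiples, hq.natDegree_mul (monic_X_pow _), natDegree_X_pow]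

theorem natDegree_extendedMultiples_X_sub_C (y : R) (n : ℕ) (i : Fin n ⊕ Fin 1) :
    (extendedMultiples (X - C y) 1 n i).natDegree = zeroLastEquiv n i := by
  rcases i with a | a
  · rw [extendedMultiples, Sum.elim_inl, natDegree_powerMultiples (monic_X_sub_C y),
      natDegree_X_sub_C, val_zeroLastEquiv_inl, add_comm]
  · rw [zeroLastEquiv_inr]
    exact natDegree_one

theorem natDegree_extendedMultiples_one (n : ℕ) (i : Fin n ⊕ Fin 1) :
    (extendedMultiples (1 : R[X]) (X ^ n) n i).natDegree = finSumFinEquiv i := by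
  rw [← powerMultiples_one_comp_finSumFinEquiv]
  simp [powerMultiples]

theorem hasTransitionDet_extendedMultiples_powers (y : R) (n : ℕ) :
    HasTransitionDet (extendedMultiples (X - C y) 1 n) (powerMultiples 1 (n + 1) ∘ zeroLastEquiv n)
      (1 : R) := by
  have hpow : powerMultiples (1 : R[X]) (n + 1) ∘ zeroLastEquiv n =
      fun i => X ^ (zeroLastEquiv n i : ℕ) := by
    ext1 i
    exact one_mul _
  rw [hpow]
  exact hasTransitionDet_X_pow_of_monic _ (monic_extendedMultiples (monic_X_sub_C y) monic_one n)
    (natDegree_extendedMultiples_X_sub_C y n)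

theorem hasTransitionDet_extendedMultiples_X_sub_C (y z : R) (n : ℕ) :
    HasTransitionDet (extendedMultiples (X - C y) 1 n) (extendedMultiples (X - C z) 1 n)
      (1 : R) := by
  simpa using (hasTransitionDet_extendedMultiples_powers y n).trans
    ((hasTransitionDet_extendedMultiples_powers z n).symm isUnit_one)

theorem hasTransitionDet_extendedMultiples_one (y : R) (n : ℕ) :
    HasTransitionDet (extendedMultiples (X - C y) 1 n) (extendedMultiples 1 (X ^ n) n)
      ((-1) ^ n : R) := by
  have htransition := hasTransitionDet_of_monic (zeroLastEquiv n) finSumFinEquiv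
    (monic_extendedMultiples (monic_X_sub_C y) monic_one n)
    (natDegree_extendedMultiples_X_sub_C y n)
    (monic_extendedMultiples monic_one (monic_X_pow n) n) (natDegree_extendedMultiples_one n)
  rw [sign_zeroLastEquiv] at htransition
  simpa using htransition

theorem hasTransitionDet_extendedMultiples_one_X_sub_C (y : R) (n : ℕ) :
    HasTransitionDet (extendedMultiples 1 (X ^ n) n) (extendedMultiples (X - C y) 1 n)
      ((-1) ^ n : R) := by
  have hunit : IsUnit ((-1) ^ n : R) := isUnit_one.neg.pow n
  have hinverse : Ring.inverse ((-1) ^ n : R) = (-1) ^ n := by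
    rw [← hunit.mul_right_inj, Ring.mul_inverse_cancel _ hunit, ← mul_pow, neg_one_mul, neg_neg,
      one_pow]
  rw [← hinverse]
  exact (hasTransitionDet_extendedMultiples_one y n).symm hunit

theorem borderedGramDet_powerMultiples (β : BilinForm R R[X]) {q q' Q : R[X]} {y y' : R}
    (hq : q * (X - C y) = Q) (hq' : q' * (X - C y') = Q) (n : ℕ) :
    borderedGramDet β (powerMultiples Q n) q q' = gramDet β q q' (n + 1) := by
  have hfactor {p : R[X]} {z : R} (hp : p * (X - C z) = Q) :
      HasTransitionDet (extendedMultiples Q p n) (powerMultiples p (n + 1) ∘ zeroLastEquiv n)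
        (1 : R) := by
    have hmap := (hasTransitionDet_extendedMultiples_powers z n).map (LinearMap.mulLeft R p)
    rwa [mulLeft_comp_extendedMultiples, ← Function.comp_assoc, mulLeft_comp_powerMultiples, hp,
      mul_one] at hmap
  have hleft := (hfactor hq).det_gramMatrix_left β (extendedMultiples Q q' n)
  rwa [one_mul, (hfactor hq').det_gramMatrix_right β (powerMultiples q (n + 1) ∘ zeroLastEquiv n),
    one_mul, det_gramMatrix_comp_equiv] at hleft

theorem borderedGramDet_borderedForm_inl [Fintype J] (β : BilinForm R R[X]) (φ : J → R[X] →ₗ[R] R)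
    {q q' Q : R[X]} {y y' : R} (hq : q * (X - C y) = Q) (hq' : q' * (X - C y') = Q) (n : ℕ) :
    borderedGramDet (borderedForm β φ) (LinearMap.inl R R[X] (J → R) ∘ powerMultiples Q n)
      (q, 0) (q', 0) = gramDet β q q' (n + 1) := by
  rw [← borderedGramDet_powerMultiples β hq hq', borderedGramDet, borderedGramDet,
    ← gramMatrix_borderedForm_inl β φ, Sum.comp_elim, Sum.comp_elim]
  rfl

end Nontrivial

variable [Fintype J] [DecidableEq J]

theorem borderedGramDet_inl_functionalVector (β : BilinForm R R[X]) (φ : J → R[X] →ₗ[R] R) {n : ℕ}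
    {q r s Q : R[X]} {y d : R} (hq : q * (X - C y) = Q)
    (h : HasTransitionDet (extendedMultiples (X - C y) 1 n) (extendedMultiples r s n) d) {j : J}
    (hφ : ∀ a, φ j (powerMultiples (q * r) n a) = 0) :
    borderedGramDet (borderedForm β φ) (LinearMap.inl R R[X] (J → R) ∘ powerMultiples Q n)
      (q, 0) (functionalVector R R[X] j) = d * (gramDet β (q * r) Q n * φ j (q * s)) := by
  have hrows := h.map (LinearMap.inl R R[X] (J → R) ∘ₗ LinearMap.mulLeft R q)
  rw [LinearMap.coe_comp, Function.comp_assoc, Function.comp_assoc, mulLeft_comp_extendedMultiples,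
    mulLeft_comp_extendedMultiples, hq, mul_one] at hrows
  have hdet := det_gramMatrix_borderedForm_left β φ (powerMultiples (q * r) n)
    (powerMultiples Q n) (fun _ : Fin 1 => q * s) (fun _ => j) fun _ => hφ
  have hleft := hrows.det_gramMatrix_left (borderedForm β φ)
    (Sum.elim (LinearMap.inl R R[X] (J → R) ∘ powerMultiples Q n)
      fun _ => functionalVector R R[X] j)
  rw [det_fin_one, of_apply] at hdet
  rw [gramDet, ← hdet]
  refine Eq.trans ?_ hleft
  rw [borderedGramDet, extendedMultiples, Sum.comp_elim]
  rfl

theorem borderedGramDet_functionalVector (β : BilinForm R R[X]) (φ : J → R[X] →ₗ[R] R) {n : ℕ}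
    {r r' s s' Q : R[X]} {d d' : R}
    (h : HasTransitionDet (extendedMultiples 1 (X ^ n) n) (extendedMultiples r s n) d)
    (h' : HasTransitionDet (extendedMultiples 1 (X ^ n) n) (extendedMultiples r' s' n) d')
    {i j : J} (hφ : ∀ a, φ j (powerMultiples (Q * r) n a) = 0)
    (hφ' : ∀ a, φ i (powerMultiples (Q * r') n a) = 0) :
    borderedGramDet (borderedForm β φ) (LinearMap.inl R R[X] (J → R) ∘ powerMultiples Q (n + 1))
      (functionalVector R R[X] i) (functionalVector R R[X] j) =
        d * d' * (gramDet β (Q * r) (Q * r') n * φ j (Q * s) * φ i (Q * s')) := by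
  have hpowers : (LinearMap.inl R R[X] (J → R) ∘ powerMultiples Q (n + 1)) ∘ finSumFinEquiv =
      (LinearMap.inl R R[X] (J → R) ∘ₗ LinearMap.mulLeft R Q) ∘ extendedMultiples 1 (X ^ n) n := by
    rw [LinearMap.coe_comp, Function.comp_assoc, Function.comp_assoc,
      ← powerMultiples_one_comp_finSumFinEquiv, ← Function.comp_assoc (LinearMap.mulLeft R Q),
      mulLeft_comp_powerMultiples, mul_one]
  have hrows := (h.map (LinearMap.inl R R[X] (J → R) ∘ₗ LinearMap.mulLeft R Q)).sumElim_left
    fun _ : Fin 1 => functionalVector R R[X] i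
  have hcols := (h'.map (LinearMap.inl R R[X] (J → R) ∘ₗ LinearMap.mulLeft R Q)).sumElim_left
    fun _ : Fin 1 => functionalVector R R[X] j
  have hblocks := det_gramMatrix_borderedForm β φ (powerMultiples (Q * r) n)
    (powerMultiples (Q * r') n) (fun _ : Fin 1 => Q * s) (fun _ => Q * s') (fun _ => i) (fun _ => j)
    (fun _ => hφ) fun _ => hφ'
  rw [det_fin_one, det_fin_one, of_apply, of_apply] at hblocks
  rw [← borderedGramDet_comp_equiv _ _ finSumFinEquiv, hpowers, borderedGramDet,
    hrows.det_gramMatrix_left, hcols.det_gramMatrix_right, gramDet, ← hblocks, mul_assoc]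
  simp only [LinearMap.coe_comp, Function.comp_assoc, mulLeft_comp_extendedMultiples]
  rfl

end BorderedGramDeterminants

section SkewGramRatios

variable {K J : Type*} [Field K] [Fintype J]

theorem skewGramRatio_borderedForm_inl (β : BilinForm K K[X]) (φ : J → K[X] →ₗ[K] K)
    {q q' Q : K[X]} {y y' : K} (hq : q * (X - C y) = Q) (hq' : q' * (X - C y') = Q) (n : ℕ) :
    skewGramRatio (borderedForm β φ) (LinearMap.inl K K[X] (J → K) ∘ powerMultiples Q n)
      (q, 0) (q', 0) =
        (gramDet β q q' (n + 1) - gramDet β q' q (n + 1)) / (2 * gramDet β Q Q n) := by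
  rw [skewGramRatio, borderedGramDet_borderedForm_inl β φ hq hq',
    borderedGramDet_borderedForm_inl β φ hq' hq, gramMatrix_borderedForm_inl, ← gramDet]

variable [DecidableEq J]

theorem skewGramRatio_inl_functionalVector (β : BilinForm K K[X]) (φ : J → K[X] →ₗ[K] K) {n : ℕ}
    {q r s Q : K[X]} {y d : K} (hq : q * (X - C y) = Q)
    (h : HasTransitionDet (extendedMultiples (X - C y) 1 n) (extendedMultiples r s n) d) {j : J}
    (hφ : ∀ a, φ j (powerMultiples (q * r) n a) = 0) :
    skewGramRatio (borderedForm β φ) (LinearMap.inl K K[X] (J → K) ∘ powerMultiples Q n)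
      (q, 0) (functionalVector K K[X] j) = d * φ j (q * s) *
        ((gramDet β Q (q * r) n + gramDet β (q * r) Q n) / (2 * gramDet β Q Q n)) := by
  have hneg (a) : (-φ) j (powerMultiples (q * r) n a) = 0 := neg_eq_zero.2 (hφ a)
  rw [skewGramRatio, borderedGramDet_inl_functionalVector β φ hq h hφ, ← borderedGramDet_flip,
    borderedForm_flip, borderedGramDet_inl_functionalVector β.flip (-φ) hq h hneg, gramDet_flip,
    gramMatrix_borderedForm_inl, ← gramDet, Pi.neg_apply, LinearMap.neg_apply]
  ring

theorem skewGramRatio_functionalVector (β : BilinForm K K[X]) (φ : J → K[X] →ₗ[K] K) {n : ℕ}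
    {r r' s s' Q : K[X]} {d d' : K}
    (h : HasTransitionDet (extendedMultiples 1 (X ^ n) n) (extendedMultiples r s n) d)
    (h' : HasTransitionDet (extendedMultiples 1 (X ^ n) n) (extendedMultiples r' s' n) d')
    {i j : J} (hφ : ∀ a, φ j (powerMultiples (Q * r) n a) = 0)
    (hφ' : ∀ a, φ i (powerMultiples (Q * r') n a) = 0) :
    skewGramRatio (borderedForm β φ) (LinearMap.inl K K[X] (J → K) ∘ powerMultiples Q (n + 1))
      (functionalVector K K[X] i) (functionalVector K K[X] j) =
        d * φ j (Q * s) * (d' * φ i (Q * s')) *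
          ((gramDet β (Q * r) (Q * r') n - gramDet β (Q * r') (Q * r) n) /
            (2 * gramDet β Q Q (n + 1))) := by
  rw [skewGramRatio, borderedGramDet_functionalVector β φ h h' hφ hφ',
    borderedGramDet_functionalVector β φ h' h hφ' hφ, gramMatrix_borderedForm_inl, ← gramDet]
  ring

end SkewGramRatios

section MainIdentity

theorem det_gramMatrix_sumElim_of_monic {R W τ ι : Type*} [CommRing R] [AddCommGroup W] [Module R W]
    [Fintype τ] [DecidableEq τ] [Fintype ι] [DecidableEq ι] (B : BilinForm R W) (A : R[X] →ₗ[R] W)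
    (g : ι → W) {n : ℕ} {u : τ → R[X]} (e : τ ≃ Fin n) (hu : ∀ s, (u s).Monic)
    (hdeg : ∀ s, (u s).natDegree = e s) :
    (gramMatrix B (Sum.elim (A ∘ u) g) (Sum.elim (A ∘ u) g)).det =
      (gramMatrix B (Sum.elim (A ∘ powerMultiples 1 n) g)
        (Sum.elim (A ∘ powerMultiples 1 n) g)).det := by
  have htransition := ((hasTransitionDet_X_pow_of_monic e hu hdeg).map A).sumElim_left g
  rw [htransition.det_gramMatrix_left, htransition.det_gramMatrix_right, one_mul, one_mul,
    ← det_gramMatrix_comp_equiv B _ _ (Equiv.sumCongr e (Equiv.refl ι))]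
  congr 2 <;> ext (s | i) <;> simp [powerMultiples]

variable {K J : Type*} [Field K] [Fintype J] [DecidableEq J]

/-- The vectors bordering the family `Q, Q X, …`, where `Q` is the nodal polynomial of `kap`: the
numerators of the partial fractions `Q / (X - κ_i)` and one vector for each functional. -/
noncomputable def borderVector {k : ℕ} (kap : Fin k → K) : Fin k ⊕ J → K[X] × (J → K) :=
  Sum.elim (LinearMap.inl K K[X] (J → K) ∘ fun i => nodal (univ.erase i) kap)
    (functionalVector K K[X])

theorem det_gramMatrix_borderVector (B : BilinForm K (K[X] × (J → K))) {k L n : ℕ} {kap : Fin k → K}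
    (hkap : Function.Injective kap) (hn : k + L = n) :
    (gramMatrix B
        (Sum.elim (LinearMap.inl K K[X] (J → K) ∘ powerMultiples (nodal univ kap) L)
          (borderVector kap))
        (Sum.elim (LinearMap.inl K K[X] (J → K) ∘ powerMultiples (nodal univ kap) L)
          (borderVector kap))).det =
      vandermondeProd kap ^ 2 * (gramMatrix B
        (Sum.elim (LinearMap.inl K K[X] (J → K) ∘ powerMultiples 1 n) (functionalVector K K[X]))
        (Sum.elim (LinearMap.inl K K[X] (J → K) ∘ powerMultiples 1 n)
          (functionalVector K K[X]))).det := by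
  have htransition := (((hasTransitionDet_nodal_erase hkap).map (LinearMap.inl K K[X] (J → K))
    ).sumElim_left (functionalVector K K[X])).sumElim_right
      (LinearMap.inl K K[X] (J → K) ∘ powerMultiples (nodal univ kap) L)
  let u : Fin L ⊕ Fin k → K[X] :=
    Sum.elim (powerMultiples (nodal univ kap) L) fun b : Fin k => X ^ (b : ℕ)
  let e : Fin L ⊕ Fin k ≃ Fin n :=
    ((Equiv.sumComm _ _).trans finSumFinEquiv).trans (finCongr hn)
  have hu (s) : (u s).Monic := by
    rcases s with a | b
    · exact monic_powerMultiples nodal_monic L a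
    · exact monic_X_pow _
  have hdeg (s) : (u s).natDegree = e s := by
    rcases s with a | b
    · simp [u, e, natDegree_powerMultiples nodal_monic, natDegree_nodal]
    · simp [u, e]
  rw [borderVector, htransition.det_gramMatrix_left, htransition.det_gramMatrix_right, ← mul_assoc,
    ← sq, vandermondeProd_neg_sq, ← det_gramMatrix_sumElim_of_monic B _ _ e hu hdeg,
    ← det_gramMatrix_comp_equiv B _ _ (Equiv.sumAssoc (Fin L) (Fin k) J)]
  congr 3 <;> ext1 ((a | b) | j) <;> rfl

theorem gramDet_mul_eq_det_skewGramRatio [NeZero (2 : K)] {β : BilinForm K K[X]} {w : K[X] → K}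
    (hβ : ∀ p q, β p q + β q p = w p * w q) (φ : J → K[X] →ₗ[K] K) {N k L n : ℕ} {kap : Fin k → K}
    (hkap : Function.Injective kap) (hn : k + L = n) {P : K[X]} (hP : P.Monic) {c : J → K[X]}
    (hc : ∀ j, (c j).Monic) (e : Fin N ⊕ J ≃ Fin n)
    (hPdeg : ∀ a : Fin N, P.natDegree + a = e (Sum.inl a))
    (hcdeg : ∀ j, (c j).natDegree = e (Sum.inr j))
    (hφ : ∀ j (a : Fin N), φ j (P * X ^ (a : ℕ)) = 0)
    (hdet : gramDet β (nodal univ kap) (nodal univ kap) L ≠ 0)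
    (heven : Even (k + Fintype.card J)) :
    gramDet β P P N * (of fun i j => φ j (c i)).det ^ 2 * vandermondeProd kap ^ 2 =
      gramDet β (nodal univ kap) (nodal univ kap) L *
        (of fun s t => skewGramRatio (borderedForm β φ)
          (LinearMap.inl K K[X] (J → K) ∘ powerMultiples (nodal univ kap) L)
          (borderVector kap s) (borderVector kap t)).det := by
  have hu (s) : (Sum.elim (powerMultiples P N) c s).Monic := by
    rcases s with a | j
    · exact monic_powerMultiples hP N a
    · exact hc j
  have hdeg (s) : (Sum.elim (powerMultiples P N) c s).natDegree = e s := by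
    rcases s with a | j
    · rw [Sum.elim_inl, natDegree_powerMultiples hP, hPdeg]
    · exact hcdeg j
  have hblocks := det_gramMatrix_borderedForm β φ (powerMultiples P N) (powerMultiples P N) c c
    id id hφ hφ
  have hnodal : gramDet β (nodal univ kap) (nodal univ kap) L = _ :=
    congrArg det (gramMatrix_borderedForm_inl β φ _ _).symm
  rw [hnodal] at hdet ⊢
  rw [← det_gramMatrix_sumElim_eq_det_skewGramRatio (borderedForm_add_swap hβ φ) hdet
      (by simpa using heven),
    det_gramMatrix_borderVector _ hkap hn, ← det_gramMatrix_sumElim_of_monic _ _ _ e hu hdeg]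
  rw [Function.comp_id] at hblocks
  rw [hblocks]
  simp only [id, gramDet]
  ring

end MainIdentity

section Andreief

variable {𝕜 X Y ι : Type*} [RCLike 𝕜] [MeasurableSpace X] {μ : Measure X} [SigmaFinite μ]
  [MeasurableSpace Y] {ν : Measure Y} [SigmaFinite ν] [Fintype ι] [DecidableEq ι]

theorem integrable_det_pi {h : ι → ι → X → 𝕜} (hh : ∀ a j, Integrable (h a j) μ) :
    Integrable (fun x : ι → X => (of fun a j => h a j (x j)).det) (Measure.pi fun _ => μ) := by
  simp only [det_apply', of_apply]
  exact integrable_finsetSum _ fun σ _ =>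
    (Integrable.fintype_prod fun j => hh (σ j) j).const_mul _

theorem integral_det_pi {h : ι → ι → X → 𝕜} (hh : ∀ a j, Integrable (h a j) μ) :
    ∫ x : ι → X, (of fun a j => h a j (x j)).det ∂(Measure.pi fun _ => μ) =
      (of fun a j => ∫ x, h a j x ∂μ).det := by
  simp only [det_apply', of_apply]
  rw [integral_finsetSum _ fun σ _ => (Integrable.fintype_prod fun j => hh (σ j) j).const_mul _]
  refine sum_congr rfl fun σ _ => ?_
  rw [integral_const_mul, integral_fintype_prod_eq_prod fun j => h (σ j) j]

theorem integral_det_mul_det {f g : ι → X → 𝕜} (h : ∀ a b, Integrable (fun x => f a x * g b x) μ) :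
    ∫ x : ι → X, (of fun a j => f a (x j)).det * (of fun b j => g b (x j)).det
        ∂(Measure.pi fun _ => μ) =
      (Fintype.card ι).factorial * (of fun a b => ∫ x, f a x * g b x ∂μ).det := by
  have hexpand (x : ι → X) : (of fun a j => f a (x j)).det * (of fun b j => g b (x j)).det =
      ∑ σ : Equiv.Perm ι, (Equiv.Perm.sign σ : 𝕜) *
        (of fun b j => f (σ j) (x j) * g b (x j)).det := by
    rw [det_apply', sum_mul]
    refine sum_congr rfl fun σ _ => ?_
    rw [mul_assoc]
    exact congrArg _ (det_mul_row (fun j => f (σ j) (x j)) (of fun b j => g b (x j))).symm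
  have hterm (σ : Equiv.Perm ι) : ∫ x : ι → X, (Equiv.Perm.sign σ : 𝕜) *
      (of fun b j => f (σ j) (x j) * g b (x j)).det ∂(Measure.pi fun _ => μ) =
        (of fun a b => ∫ x, f a x * g b x ∂μ).det := by
    rw [integral_const_mul, integral_det_pi fun b j => h (σ j) b,
      ← det_transpose (of fun b j => ∫ x, f (σ j) x * g b x ∂μ)]
    refine (congrArg _ (det_permute σ (of fun a b => ∫ x, f a x * g b x ∂μ))).trans ?_
    rw [← mul_assoc, ← Int.cast_mul, ← Units.val_mul, Int.units_mul_self, Units.val_one,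
      Int.cast_one, one_mul]
  simp only [hexpand]
  rw [integral_finsetSum _ fun σ _ => (integrable_det_pi fun b j => h (σ j) b).const_mul _]
  simp only [hterm, sum_const, card_univ, Fintype.card_perm, nsmul_eq_mul]

theorem integrable_det_mul_det_mul_det {f : ι → X → 𝕜} {g : ι → Y → 𝕜} {w : X → Y → 𝕜} {c : ℝ}
    (hf : ∀ a, Integrable (f a) μ) (hg : ∀ b, Integrable (g b) ν)
    (hw : Measurable fun z : X × Y => w z.1 z.2) (hwc : ∀ x y, ‖w x y‖ ≤ c) :
    Integrable (fun p : (ι → X) × (ι → Y) => (of fun a j => f a (p.1 j)).det *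
        ((of fun b j => g b (p.2 j)).det * (of fun i j => w (p.1 i) (p.2 j)).det))
      ((Measure.pi fun _ => μ).prod (Measure.pi fun _ => ν)) := by
  have hmeas : Measurable fun p : (ι → X) × (ι → Y) => (of fun i j => w (p.1 i) (p.2 j)).det := by
    simp only [det_apply', of_apply]
    fun_prop
  have hbound (p : (ι → X) × (ι → Y)) : ‖(of fun i j => w (p.1 i) (p.2 j)).det‖ ≤
      (Fintype.card ι).factorial • c ^ Fintype.card ι :=
    det_le (abv := NormedField.toAbsoluteValue 𝕜) fun i j => hwc (p.1 i) (p.2 j)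
  simp only [← mul_assoc]
  exact ((integrable_det_pi fun a _ => hf a).mul_prod (integrable_det_pi fun b _ => hg b)).mul_bdd
    hmeas.aestronglyMeasurable (Filter.Eventually.of_forall hbound)

theorem integral_det_mul_det_mul_det {f : ι → X → 𝕜} {g : ι → Y → 𝕜} {w : X → Y → 𝕜} {c : ℝ}
    (hf : ∀ a, Integrable (f a) μ) (hg : ∀ b, Integrable (g b) ν)
    (hw : Measurable fun z : X × Y => w z.1 z.2) (hwc : ∀ x y, ‖w x y‖ ≤ c) :
    ∫ p : (ι → X) × (ι → Y), (of fun a j => f a (p.1 j)).det *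
        ((of fun b j => g b (p.2 j)).det * (of fun i j => w (p.1 i) (p.2 j)).det)
        ∂((Measure.pi fun _ => μ).prod (Measure.pi fun _ => ν)) =
      (Fintype.card ι).factorial ^ 2 *
        (of fun a b => ∫ z, f a z.1 * (g b z.2 * w z.1 z.2) ∂(μ.prod ν)).det := by
  have hgw (x b) : Integrable (fun y => g b y * w x y) ν :=
    (hg b).mul_bdd hw.of_uncurry_left.aestronglyMeasurable (Filter.Eventually.of_forall (hwc x))
  have hfgw (a b) : Integrable (fun z : X × Y => f a z.1 * (g b z.2 * w z.1 z.2)) (μ.prod ν) := by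
    simp only [← mul_assoc]
    exact ((hf a).mul_prod (hg b)).mul_bdd hw.aestronglyMeasurable
      (Filter.Eventually.of_forall fun z => hwc z.1 z.2)
  have hinner (x : ι → X) : ∫ y : ι → Y, (of fun a j => f a (x j)).det *
      ((of fun b j => g b (y j)).det * (of fun i j => w (x i) (y j)).det)
        ∂(Measure.pi fun _ => ν) =
      (Fintype.card ι).factorial * ((of fun a j => f a (x j)).det *
        (of fun b j => ∫ y, g b y * w (x j) y ∂ν).det) := by
    rw [integral_const_mul, integral_det_mul_det fun b i => hgw (x i) b, mul_left_comm]
  have houter (a b) : Integrable (fun x => f a x * ∫ y, g b y * w x y ∂ν) μ := by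
    simpa only [integral_const_mul] using (hfgw a b).integral_prod_left
  rw [integral_prod _ (integrable_det_mul_det_mul_det hf hg hw hwc)]
  simp only [hinner]
  rw [integral_const_mul, integral_det_mul_det houter, ← mul_assoc, ← sq]
  simp only [integral_prod _ (hfgw _ _), integral_const_mul]

end Andreief

section CauchyPairing

/-- The function `y / (x + y)` of the Cauchy interaction on the positive quadrant, extended by
absolute values to a bounded function on the plane. -/
noncomputable def cauchyWeight (x y : ℝ) : ℂ := ((|y| / (|x| + |y|) : ℝ) : ℂ)

theorem measurable_cauchyWeight : Measurable fun z : ℝ × ℝ => cauchyWeight z.1 z.2 := by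
  unfold cauchyWeight
  fun_prop

theorem norm_cauchyWeight_le_one (x y : ℝ) : ‖cauchyWeight x y‖ ≤ 1 := by
  rw [cauchyWeight, Complex.norm_real, Real.norm_of_nonneg (by positivity)]
  exact div_le_one_of_le₀ (le_add_of_nonneg_left (abs_nonneg x)) (by positivity)

theorem cauchyWeight_of_pos {x y : ℝ} (hx : 0 < x) (hy : 0 < y) :
    cauchyWeight x y = y * ((x + y : ℝ) : ℂ)⁻¹ := by
  rw [cauchyWeight, abs_of_pos hx, abs_of_pos hy, Complex.ofReal_div, div_eq_mul_inv]

theorem cauchyWeight_add_swap {x y : ℝ} (hx : 0 < x) (hy : 0 < y) :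
    cauchyWeight x y + cauchyWeight y x = 1 := by
  have hxy : ((x + y : ℝ) : ℂ) ≠ 0 := Complex.ofReal_ne_zero.2 (add_pos hx hy).ne'
  rw [cauchyWeight_of_pos hx hy, cauchyWeight_of_pos hy hx, add_comm y x, ← add_mul,
    ← Complex.ofReal_add, add_comm y x, mul_inv_cancel₀ hxy]

/-- The pairing `∬ f(x) g(y) y / (x + y) dx dy` over the positive quadrant, whose Gram determinants
are the partition functions of the Cauchy two-matrix model. -/
noncomputable def cauchyPairing (f g : ℝ → ℂ) : ℂ :=
  ∫ z : ℝ × ℝ, f z.1 * (g z.2 * cauchyWeight z.1 z.2)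
    ∂(volume.restrict (Set.Ioi 0)).prod (volume.restrict (Set.Ioi 0))

theorem ae_pos_prod_restrict_Ioi : ∀ᵐ z : ℝ × ℝ
    ∂(volume.restrict (Set.Ioi 0)).prod (volume.restrict (Set.Ioi 0)), 0 < z.1 ∧ 0 < z.2 := by
  rw [Measure.prod_restrict]
  exact ae_restrict_mem (measurableSet_Ioi.prod measurableSet_Ioi)

theorem ae_pos_positiveLebesgue (N : ℕ) : ∀ᵐ x ∂positiveLebesgue N, ∀ j, 0 < x j := by
  have hpos : ∀ᵐ t : ℝ ∂volume.restrict (Set.Ioi 0), 0 < t := ae_restrict_mem measurableSet_Ioi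
  exact ae_all_iff.2 fun j => (Measure.tendsto_eval_ae_ae (i := j)).eventually hpos

variable {f f' g g' : ℝ → ℂ}

theorem cauchyPairing_congr (hf : Set.EqOn f f' (Set.Ioi 0)) (hg : Set.EqOn g g' (Set.Ioi 0)) :
    cauchyPairing f g = cauchyPairing f' g' := by
  refine integral_congr_ae ?_
  filter_upwards [ae_pos_prod_restrict_Ioi] with z hz
  rw [hf hz.1, hg hz.2]

theorem integrable_mul_mul_cauchyWeight (hf : IntegrableOn f (Set.Ioi 0))
    (hg : IntegrableOn g (Set.Ioi 0)) :
    Integrable (fun z : ℝ × ℝ => f z.1 * (g z.2 * cauchyWeight z.1 z.2))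
      ((volume.restrict (Set.Ioi 0)).prod (volume.restrict (Set.Ioi 0))) := by
  simp only [← mul_assoc]
  exact (hf.mul_prod hg).mul_bdd (c := 1) measurable_cauchyWeight.aestronglyMeasurable
    (.of_forall fun z => norm_cauchyWeight_le_one z.1 z.2)

theorem cauchyPairing_add_swap (hf : IntegrableOn f (Set.Ioi 0))
    (hg : IntegrableOn g (Set.Ioi 0)) :
    cauchyPairing f g + cauchyPairing g f =
      (∫ x in Set.Ioi 0, f x) * ∫ x in Set.Ioi 0, g x := by
  have hswap : cauchyPairing g f = ∫ z : ℝ × ℝ, g z.2 * (f z.1 * cauchyWeight z.2 z.1)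
      ∂(volume.restrict (Set.Ioi 0)).prod (volume.restrict (Set.Ioi 0)) :=
    (integral_prod_swap _).symm
  rw [hswap, cauchyPairing, ← integral_prod_mul]
  refine (integral_add (integrable_mul_mul_cauchyWeight hf hg)
    (integrable_mul_mul_cauchyWeight hg hf).swap).symm.trans (integral_congr_ae ?_)
  filter_upwards [ae_pos_prod_restrict_Ioi] with z hz
  simp only [Function.comp_apply, Prod.fst_swap, Prod.snd_swap]
  linear_combination f z.1 * g z.2 * cauchyWeight_add_swap hz.1 hz.2

theorem det_mul_pow_eq_prod_mul_vandermondeProd {N : ℕ} (r : ℝ → ℂ) (x : Fin N → ℝ) :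
    (of fun a j : Fin N => r (x j) * (x j : ℂ) ^ (a : ℕ)).det =
      (∏ j, r (x j)) * ((vandermondeProd x : ℝ) : ℂ) := by
  have hdet := det_mul_row (fun j => r (x j)) (vandermonde fun j => (x j : ℂ))ᵀ
  rw [det_transpose, det_vandermonde] at hdet
  rw [vandermondeProd]
  push_cast
  exact hdet

theorem det_cauchyWeight {N : ℕ} {x y : Fin N → ℝ} (hx : ∀ i, 0 < x i) (hy : ∀ j, 0 < y j) :
    (of fun i j => cauchyWeight (x i) (y j)).det = (∏ j, (y j : ℂ)) *
      ((vandermondeProd x * vandermondeProd y / ∏ i, ∏ j, (x i + y j) : ℝ) : ℂ) := by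
  rw [← det_cauchy x y fun i j => (add_pos (hx i) (hy j)).ne', ← Complex.ofRealHom_eq_coe,
    Complex.ofRealHom.map_det, ← det_mul_row]
  congr 1
  ext i j
  simp [cauchyWeight_of_pos (hx i) (hy j)]

theorem cauchyPartition_eq_det {α : ℝ → ℂ} {N k₁ l₁ k₂ l₂ : ℕ} {kap₁ : Fin k₁ → ℂ}
    {lam₁ : Fin l₁ → ℂ} {kap₂ : Fin k₂ → ℂ} {lam₂ : Fin l₂ → ℂ}
    (h₁ : ∀ a : Fin N, IntegrableOn
      (fun x : ℝ => charRatio kap₁ lam₁ x * α x * (x : ℂ) ^ (a : ℕ)) (Set.Ioi 0))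
    (h₂ : ∀ a : Fin N, IntegrableOn
      (fun x : ℝ => charRatio kap₂ lam₂ x * α x * (x : ℂ) ^ (a : ℕ)) (Set.Ioi 0)) :
    cauchyPartition α N kap₁ lam₁ kap₂ lam₂ =
      (of fun a b : Fin N => cauchyPairing
        (fun x => charRatio kap₁ lam₁ x * α x * (x : ℂ) ^ (a : ℕ))
        fun y => charRatio kap₂ lam₂ y * α y * (y : ℂ) ^ (b : ℕ)).det := by
  have hfact : (N.factorial : ℂ) ^ 2 ≠ 0 := pow_ne_zero _ (Nat.cast_ne_zero.2 N.factorial_ne_zero)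
  have hAndreief := integral_det_mul_det_mul_det h₁ h₂ measurable_cauchyWeight
    norm_cauchyWeight_le_one
  rw [Fintype.card_fin] at hAndreief
  rw [cauchyPartition, one_div, inv_mul_eq_iff_eq_mul₀ hfact]
  refine Eq.trans (integral_congr_ae ?_) hAndreief
  have hx := Measure.quasiMeasurePreserving_fst (μ := positiveLebesgue N)
    (ν := positiveLebesgue N) |>.ae (ae_pos_positiveLebesgue N)
  have hy := Measure.quasiMeasurePreserving_snd (μ := positiveLebesgue N)
    (ν := positiveLebesgue N) |>.ae (ae_pos_positiveLebesgue N)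
  filter_upwards [hx, hy] with p hx hy
  rw [det_mul_pow_eq_prod_mul_vandermondeProd (fun x => charRatio kap₁ lam₁ x * α x),
    det_mul_pow_eq_prod_mul_vandermondeProd (fun y => charRatio kap₂ lam₂ y * α y),
    det_cauchyWeight hx hy]
  simp only [prod_mul_distrib]
  push_cast
  ring

end CauchyPairing

section CauchyForm

/-- Integrability on the positive half-line of `x ^ a` against the weight `ρ` for all `a < n`. -/
def HasMoments (ρ : ℝ → ℂ) (n : ℕ) : Prop :=
  ∀ a < n, IntegrableOn (fun x : ℝ => (x : ℂ) ^ a * ρ x) (Set.Ioi 0)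

/-- The bilinear form `(p, q) ↦ cauchyPairing (p ρ) (q ρ)` on polynomials of degree less than `n`,
extended to all polynomials by forgetting the coefficients of degree at least `n`, whose moments
need not exist. -/
noncomputable def cauchyForm (ρ : ℝ → ℂ) (n : ℕ) : BilinForm ℂ ℂ[X] :=
  (toBilin' (of fun a b : Fin n => cauchyPairing (fun x => (x : ℂ) ^ (a : ℕ) * ρ x)
    fun y => (y : ℂ) ^ (b : ℕ) * ρ y)).comp
    (LinearMap.pi fun a : Fin n => lcoeff ℂ a) (LinearMap.pi fun b : Fin n => lcoeff ℂ b)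

theorem cauchyForm_eq_sum (ρ : ℝ → ℂ) (n : ℕ) (p q : ℂ[X]) :
    cauchyForm ρ n p q = ∑ a : Fin n, ∑ b : Fin n, p.coeff a * q.coeff b *
      cauchyPairing (fun x => (x : ℂ) ^ (a : ℕ) * ρ x) fun y => (y : ℂ) ^ (b : ℕ) * ρ y := by
  rw [cauchyForm, LinearMap.BilinForm.comp_apply, toBilin'_apply]
  exact sum_congr rfl fun a _ => sum_congr rfl fun b _ => mul_right_comm _ _ _

theorem eval_mul_eq_sum_fin {R : Type*} [CommSemiring R] {p : R[X]} {n : ℕ} (hp : p.natDegree < n)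
    (x y : R) : p.eval x * y = ∑ a : Fin n, p.coeff a * (x ^ (a : ℕ) * y) := by
  rw [eval_eq_sum_range' hp, sum_range, sum_mul]
  exact sum_congr rfl fun a _ => mul_assoc _ _ _

variable {ρ : ℝ → ℂ} {n : ℕ}

theorem HasMoments.integrableOn_eval_mul (hρ : HasMoments ρ n) {p : ℂ[X]} (hp : p.natDegree < n) :
    IntegrableOn (fun x : ℝ => p.eval (x : ℂ) * ρ x) (Set.Ioi 0) := by
  simp only [eval_mul_eq_sum_fin hp]
  exact integrable_finsetSum _ fun a _ => (hρ a a.2).const_mul _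

theorem cauchyForm_add_swap (hρ : HasMoments ρ n) (p q : ℂ[X]) :
    cauchyForm ρ n p q + cauchyForm ρ n q p =
      (∑ a : Fin n, p.coeff a * ∫ x : ℝ in Set.Ioi 0, (x : ℂ) ^ (a : ℕ) * ρ x) *
        ∑ a : Fin n, q.coeff a * ∫ x : ℝ in Set.Ioi 0, (x : ℂ) ^ (a : ℕ) * ρ x := by
  rw [cauchyForm_eq_sum, cauchyForm_eq_sum, sum_comm (f := fun a b : Fin n => q.coeff a * _ * _),
    sum_mul_sum]
  simp only [← sum_add_distrib]
  refine sum_congr rfl fun a _ => sum_congr rfl fun b _ => ?_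
  linear_combination p.coeff a * q.coeff b * cauchyPairing_add_swap (hρ a a.2) (hρ b b.2)

theorem cauchyForm_apply (hρ : HasMoments ρ n) {p q : ℂ[X]} (hp : p.natDegree < n)
    (hq : q.natDegree < n) :
    cauchyForm ρ n p q =
      cauchyPairing (fun x => p.eval (x : ℂ) * ρ x) fun y => q.eval (y : ℂ) * ρ y := by
  have hint (a b : Fin n) := (integrable_mul_mul_cauchyWeight (hρ a a.2) (hρ b b.2)).const_mul
    (p.coeff a * q.coeff b)
  rw [cauchyForm_eq_sum]
  simp only [cauchyPairing, ← integral_const_mul]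
  calc _ = ∫ z : ℝ × ℝ, ∑ a : Fin n, ∑ b : Fin n, p.coeff a * q.coeff b *
          ((z.1 : ℂ) ^ (a : ℕ) * ρ z.1 * ((z.2 : ℂ) ^ (b : ℕ) * ρ z.2 * cauchyWeight z.1 z.2))
          ∂(volume.restrict (Set.Ioi 0)).prod (volume.restrict (Set.Ioi 0)) := by
        rw [integral_finsetSum _ fun a _ => integrable_finsetSum _ fun b _ => hint a b]
        exact sum_congr rfl fun a _ => (integral_finsetSum _ fun b _ => hint a b).symm
    _ = _ := by
        congr 1 with z
        rw [eval_mul_eq_sum_fin hp, eval_mul_eq_sum_fin hq, ← mul_assoc, sum_mul_sum]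
        simp only [sum_mul]
        exact sum_congr rfl fun a _ => sum_congr rfl fun b _ => by ring

theorem cauchyPartition_eq_gramDet (hρ : HasMoments ρ n) {α : ℝ → ℂ} {N k₁ l₁ k₂ l₂ : ℕ}
    {kap₁ : Fin k₁ → ℂ} {lam₁ : Fin l₁ → ℂ} {kap₂ : Fin k₂ → ℂ} {lam₂ : Fin l₂ → ℂ} {p q : ℂ[X]}
    (hp : p.natDegree + N ≤ n) (hq : q.natDegree + N ≤ n)
    (h₁ : ∀ x : ℝ, 0 < x → charRatio kap₁ lam₁ x * α x = p.eval (x : ℂ) * ρ x)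
    (h₂ : ∀ x : ℝ, 0 < x → charRatio kap₂ lam₂ x * α x = q.eval (x : ℂ) * ρ x) :
    cauchyPartition α N kap₁ lam₁ kap₂ lam₂ = gramDet (cauchyForm ρ n) p q N := by
  have hdeg {r : ℂ[X]} (hr : r.natDegree + N ≤ n) (a : Fin N) :
      (powerMultiples r N a).natDegree < n := by
    refine natDegree_mul_le.trans_lt ?_
    rw [natDegree_X_pow]
    exact (Nat.add_lt_add_left a.isLt _).trans_le hr
  have heval {k l : ℕ} {kap : Fin k → ℂ} {lam : Fin l → ℂ} {r : ℂ[X]}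
      (h : ∀ x : ℝ, 0 < x → charRatio kap lam x * α x = r.eval (x : ℂ) * ρ x) (a : Fin N) :
      Set.EqOn (fun x : ℝ => charRatio kap lam x * α x * (x : ℂ) ^ (a : ℕ))
        (fun x => (powerMultiples r N a).eval (x : ℂ) * ρ x) (Set.Ioi 0) := fun x hx => by
    dsimp only
    rw [h x hx, powerMultiples, eval_mul, eval_pow, eval_X]
    exact mul_right_comm _ _ _
  have hint {k l : ℕ} {kap : Fin k → ℂ} {lam : Fin l → ℂ} {r : ℂ[X]} (hr : r.natDegree + N ≤ n)
      (h : ∀ x : ℝ, 0 < x → charRatio kap lam x * α x = r.eval (x : ℂ) * ρ x) (a : Fin N) :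
      IntegrableOn (fun x : ℝ => charRatio kap lam x * α x * (x : ℂ) ^ (a : ℕ)) (Set.Ioi 0) :=
    (hρ.integrableOn_eval_mul (hdeg hr a)).congr_fun (heval h a).symm measurableSet_Ioi
  rw [cauchyPartition_eq_det (hint hp h₁) (hint hq h₂), gramDet]
  congr 1
  ext a b
  exact (cauchyPairing_congr (heval h₁ a) (heval h₂ b)).trans
    (cauchyForm_apply hρ (hdeg hp a) (hdeg hq b)).symm

theorem exists_one_add_div_norm_sub_le {c : ℂ} (hc : ∀ t : ℝ, 0 ≤ t → c ≠ t) :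
    ∃ C : ℝ, ∀ x : ℝ, 0 ≤ x → (1 + x) / ‖(x : ℂ) - c‖ ≤ C := by
  have hclosed : IsClosed (Complex.ofReal '' Set.Ici 0) :=
    Complex.isometry_ofReal.isClosedEmbedding.isClosedMap _ isClosed_Ici
  have hmem : c ∉ Complex.ofReal '' Set.Ici 0 := fun ⟨t, ht, htc⟩ => hc t ht htc.symm
  obtain ⟨δ, hδ, hball⟩ := Metric.isOpen_iff.1 hclosed.isOpen_compl c hmem
  refine ⟨1 + (1 + ‖c‖) / δ, fun x hx => ?_⟩
  have hle : δ ≤ ‖(x : ℂ) - c‖ := by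
    by_contra! hlt
    exact hball (mem_ball_iff_norm.2 hlt) ⟨x, hx, rfl⟩
  have hpos : 0 < ‖(x : ℂ) - c‖ := hδ.trans_le hle
  have hxle : x ≤ ‖(x : ℂ) - c‖ + ‖c‖ := by
    simpa [abs_of_nonneg hx] using norm_add_le ((x : ℂ) - c) c
  calc (1 + x) / ‖(x : ℂ) - c‖ ≤ (‖(x : ℂ) - c‖ + (1 + ‖c‖)) / ‖(x : ℂ) - c‖ :=
        div_le_div_of_nonneg_right (by linarith) hpos.le
    _ = 1 + (1 + ‖c‖) / ‖(x : ℂ) - c‖ := by rw [add_div, div_self hpos.ne']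
    _ ≤ 1 + (1 + ‖c‖) / δ := by gcongr

theorem exists_norm_pow_div_eval_nodal_le {k d : ℕ} {kap : Fin k → ℂ}
    (hkap : ∀ i, ∀ t : ℝ, 0 ≤ t → kap i ≠ t) (hd : d ≤ k) :
    ∃ C : ℝ, ∀ x : ℝ, 0 ≤ x → ‖(x : ℂ) ^ d / (nodal univ kap).eval (x : ℂ)‖ ≤ C := by
  choose B hB using fun i => exists_one_add_div_norm_sub_le (hkap i)
  refine ⟨∏ i, B i, fun x hx => ?_⟩
  calc ‖(x : ℂ) ^ d / (nodal univ kap).eval (x : ℂ)‖ = x ^ d / ∏ i, ‖(x : ℂ) - kap i‖ := by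
        rw [eval_nodal, norm_div, norm_pow, Complex.norm_real, Real.norm_of_nonneg hx, norm_prod]
    _ ≤ (1 + x) ^ k / ∏ i, ‖(x : ℂ) - kap i‖ := by
        gcongr
        exact (pow_le_pow_left₀ hx (by linarith) d).trans (pow_le_pow_right₀ (by linarith) hd)
    _ = ∏ i, (1 + x) / ‖(x : ℂ) - kap i‖ := by
        rw [prod_div_distrib, prod_const, card_fin]
    _ ≤ ∏ i, B i := prod_le_prod (fun i _ => by positivity) fun i _ => hB i x hx

/-- The weight `α / Q` left after clearing the common denominator `Q`. -/
noncomputable def quotientWeight (α : ℝ → ℂ) (Q : ℂ[X]) (x : ℝ) : ℂ := α x / Q.eval (x : ℂ)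

theorem HasMoments.quotientWeight_nodal {α : ℝ → ℂ} {k L : ℕ} (hα : HasMoments α L) (hL : 0 < L)
    {kap : Fin k → ℂ} (hkap : ∀ i, ∀ t : ℝ, 0 ≤ t → kap i ≠ t) :
    HasMoments (quotientWeight α (nodal univ kap)) (k + L) := by
  intro a ha
  obtain ⟨d, c, hd, hc, rfl⟩ : ∃ d c, d ≤ k ∧ c < L ∧ a = d + c :=
    ⟨min a k, a - k, by lia, by lia, by lia⟩
  obtain ⟨C, hC⟩ := exists_norm_pow_div_eval_nodal_le hkap hd
  have hmeas : Measurable fun x : ℝ => (x : ℂ) ^ d / (nodal univ kap).eval (x : ℂ) := by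
    simp only [eval_nodal]
    fun_prop
  have hbound : ∀ᵐ x : ℝ ∂volume.restrict (Set.Ioi 0),
      ‖(x : ℂ) ^ d / (nodal univ kap).eval (x : ℂ)‖ ≤ C := by
    filter_upwards [ae_restrict_mem measurableSet_Ioi] with x hx using hC x (le_of_lt hx)
  refine ((hα c hc).bdd_mul hmeas.aestronglyMeasurable hbound).congr (.of_forall fun x => ?_)
  simp only [quotientWeight, pow_add]
  ring

end CauchyForm

section KernelEntries

/-- The function `∏ i, (x - lam i) / ∏ i, (x - kap i)` has numerator `p` over the common
denominator `Q`. -/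
def IsCharRatioNumerator (Q : ℂ[X]) {k l : ℕ} (kap : Fin k → ℂ) (lam : Fin l → ℂ) (p : ℂ[X]) :
    Prop :=
  ∃ q, q * nodal univ kap = Q ∧ q * nodal univ lam = p

section IsCharRatioNumerator

variable {Q q : ℂ[X]} {c : ℂ}

theorem isCharRatioNumerator_nil_nil (Q : ℂ[X]) : IsCharRatioNumerator Q ![] ![] Q :=
  ⟨Q, by simp [nodal], by simp [nodal]⟩

theorem isCharRatioNumerator_nil_singleton (Q : ℂ[X]) (y : ℂ) :
    IsCharRatioNumerator Q ![] ![y] (Q * (X - C y)) :=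
  ⟨Q, by simp [nodal], by simp [nodal]⟩

theorem isCharRatioNumerator_singleton_nil (hq : q * (X - C c) = Q) :
    IsCharRatioNumerator Q ![c] ![] q :=
  ⟨q, by simpa [nodal] using hq, by simp [nodal]⟩

theorem isCharRatioNumerator_singleton_singleton (hq : q * (X - C c) = Q) (y : ℂ) :
    IsCharRatioNumerator Q ![c] ![y] (q * (X - C y)) :=
  ⟨q, by simpa [nodal] using hq, by simp [nodal]⟩

theorem isCharRatioNumerator_nodal {k l : ℕ} (kap : Fin k → ℂ) (lam : Fin l → ℂ) :
    IsCharRatioNumerator (nodal univ kap) kap lam (nodal univ lam) :=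
  ⟨1, one_mul _, one_mul _⟩

theorem IsCharRatioNumerator.charRatio_mul {k l : ℕ} {kap : Fin k → ℂ} {lam : Fin l → ℂ} {p : ℂ[X]}
    (h : IsCharRatioNumerator Q kap lam p) (α : ℝ → ℂ) {x : ℝ} (hx : Q.eval (x : ℂ) ≠ 0) :
    charRatio kap lam x * α x = p.eval (x : ℂ) * quotientWeight α Q x := by
  obtain ⟨q, rfl, rfl⟩ := h
  rw [eval_mul] at hx
  rw [charRatio, quotientWeight, eval_mul, eval_mul, ← eval_nodal, ← eval_nodal,
    ← mul_div_mul_left _ _ (left_ne_zero_of_mul hx)]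
  ring

end IsCharRatioNumerator

theorem natDegree_add_one_eq_of_mul_X_sub_C_eq {q Q : ℂ[X]} {c : ℂ} (hq : q * (X - C c) = Q)
    (hQ : Q ≠ 0) : q.natDegree + 1 = Q.natDegree := by
  rw [← hq] at hQ ⊢
  rw [natDegree_mul (left_ne_zero_of_mul hQ) (X_sub_C_ne_zero c), natDegree_X_sub_C]

theorem natDegree_mul_X_sub_C_le {p : ℂ[X]} (y : ℂ) :
    (p * (X - C y)).natDegree ≤ p.natDegree + 1 :=
  natDegree_mul_le.trans_eq (by rw [natDegree_X_sub_C])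

/-- Evaluation at `x`, normalized to take the value one at `Q`. -/
noncomputable def normalizedEval (Q : ℂ[X]) (x : ℂ) : ℂ[X] →ₗ[ℂ] ℂ := (Q.eval x)⁻¹ • leval x

theorem normalizedEval_apply (Q p : ℂ[X]) (x : ℂ) :
    normalizedEval Q x p = (Q.eval x)⁻¹ * p.eval x := rfl

theorem normalizedEval_powerMultiples_mul_X_sub_C (Q p : ℂ[X]) (x : ℂ) (n : ℕ) (a : Fin n) :
    normalizedEval Q x (powerMultiples (p * (X - C x)) n a) = 0 := by
  simp [normalizedEval_apply, powerMultiples]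

theorem normalizedEval_self {Q : ℂ[X]} {x : ℂ} (hQ : Q.eval x ≠ 0) : normalizedEval Q x Q = 1 :=
  inv_mul_cancel₀ hQ

theorem normalizedEval_eq_inv_sub {c x : ℂ} {q Q : ℂ[X]} (hq : q * (X - C c) = Q)
    (hQ : Q.eval x ≠ 0) : normalizedEval Q x q = (x - c)⁻¹ := by
  rw [← hq, eval_mul] at hQ
  rw [normalizedEval_apply, ← hq, eval_mul, _root_.mul_inv_rev, inv_mul_cancel_right₀
    (left_ne_zero_of_mul hQ), eval_sub, eval_X, eval_C]

/-- The coefficient of degree `m + L`, with the sign `(-1) ^ L` of the rotation that moves the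
leading term past the `L` other multiples of a polynomial of degree `m`. -/
noncomputable def signedCoeff (m L : ℕ) : ℂ[X] →ₗ[ℂ] ℂ := (-1 : ℂ) ^ L • lcoeff ℂ (m + L)

theorem signedCoeff_apply (m L : ℕ) (p : ℂ[X]) :
    signedCoeff m L p = (-1) ^ L * p.coeff (m + L) := rfl

theorem signedCoeff_eq_zero {m L : ℕ} {p : ℂ[X]} (hp : p.natDegree < m + L) :
    signedCoeff m L p = 0 := by
  rw [signedCoeff_apply, coeff_eq_zero_of_natDegree_lt hp, mul_zero]

theorem signedCoeff_of_monic {m L : ℕ} {p : ℂ[X]} (hp : p.Monic) (hdeg : p.natDegree = m + L) :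
    signedCoeff m L p = (-1) ^ L := by
  rw [signedCoeff_apply, ← hdeg, hp.coeff_natDegree, mul_one]

variable {J : Type*} [Fintype J] {α : ℝ → ℂ} {Q : ℂ[X]} {n L : ℕ}

theorem cauchyPartition_eq_gramDet_quotientWeight (hρ : HasMoments (quotientWeight α Q) n)
    (hQ : ∀ x : ℝ, 0 < x → Q.eval (x : ℂ) ≠ 0) {N k₁ l₁ k₂ l₂ : ℕ}
    {kap₁ : Fin k₁ → ℂ} {lam₁ : Fin l₁ → ℂ} {kap₂ : Fin k₂ → ℂ} {lam₂ : Fin l₂ → ℂ} {p q : ℂ[X]}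
    (h₁ : IsCharRatioNumerator Q kap₁ lam₁ p) (h₂ : IsCharRatioNumerator Q kap₂ lam₂ q)
    (hp : p.natDegree + N ≤ n) (hq : q.natDegree + N ≤ n) :
    cauchyPartition α N kap₁ lam₁ kap₂ lam₂ = gramDet (cauchyForm (quotientWeight α Q) n) p q N :=
  cauchyPartition_eq_gramDet hρ hp hq (fun x hx => h₁.charRatio_mul α (hQ x hx))
    fun x hx => h₂.charRatio_mul α (hQ x hx)

theorem cauchyNormalization_eq_gramDet (hρ : HasMoments (quotientWeight α Q) n)
    (hQ : ∀ x : ℝ, 0 < x → Q.eval (x : ℂ) ≠ 0) (hn : Q.natDegree + L ≤ n) :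
    cauchyNormalization α L = gramDet (cauchyForm (quotientWeight α Q) n) Q Q L :=
  cauchyPartition_eq_gramDet_quotientWeight hρ hQ (isCharRatioNumerator_nil_nil Q)
    (isCharRatioNumerator_nil_nil Q) hn hn

/-- The entries of the matrix in the determinantal formula, as ratios of bordered Gram
determinants: the pairing is `cauchyForm` for the weight `α / Q`, bordered by the functionals `φ`,
and the family projected out is `Q, Q X, …, Q X ^ (L - 1)`. -/
noncomputable def kernelRatio (α : ℝ → ℂ) (Q : ℂ[X]) (n L : ℕ) (φ : J → ℂ[X] →ₗ[ℂ] ℂ) :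
    ℂ[X] × (J → ℂ) → ℂ[X] × (J → ℂ) → ℂ :=
  skewGramRatio (borderedForm (cauchyForm (quotientWeight α Q) n) φ)
    (LinearMap.inl ℂ ℂ[X] (J → ℂ) ∘ powerMultiples Q L)

theorem ne_zero_of_forall_eval_ne_zero (hQ : ∀ x : ℝ, 0 < x → Q.eval (x : ℂ) ≠ 0) : Q ≠ 0 := by
  rintro rfl
  exact hQ 1 one_pos eval_zero

theorem kernelRatio_inl (hρ : HasMoments (quotientWeight α Q) n)
    (hQ : ∀ x : ℝ, 0 < x → Q.eval (x : ℂ) ≠ 0) (hn : Q.natDegree + L ≤ n)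
    (φ : J → ℂ[X] →ₗ[ℂ] ℂ) {c c' : ℂ} {q q' : ℂ[X]} (hq : q * (X - C c) = Q)
    (hq' : q' * (X - C c') = Q) :
    kernelRatio α Q n L φ (q, 0) (q', 0) = kernel11 α (L + 1) c c' := by
  have hQ0 := ne_zero_of_forall_eval_ne_zero hQ
  have hdeg := natDegree_add_one_eq_of_mul_X_sub_C_eq hq hQ0
  have hdeg' := natDegree_add_one_eq_of_mul_X_sub_C_eq hq' hQ0
  have hr := isCharRatioNumerator_singleton_nil hq
  have hr' := isCharRatioNumerator_singleton_nil hq'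
  rw [kernelRatio, skewGramRatio_borderedForm_inl _ φ hq hq', kernel11, Nat.add_sub_cancel,
    cauchyNormalization_eq_gramDet hρ hQ hn,
    cauchyPartition_eq_gramDet_quotientWeight hρ hQ hr hr' (by lia) (by lia),
    cauchyPartition_eq_gramDet_quotientWeight hρ hQ hr' hr (by lia) (by lia)]

variable [DecidableEq J]

theorem kernelRatio_inl_normalizedEval (hρ : HasMoments (quotientWeight α Q) n)
    (hQ : ∀ x : ℝ, 0 < x → Q.eval (x : ℂ) ≠ 0) (hn : Q.natDegree + L ≤ n)
    {φ : J → ℂ[X] →ₗ[ℂ] ℂ} {c y : ℂ} {q : ℂ[X]} (hq : q * (X - C c) = Q) (hy : Q.eval y ≠ 0)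
    {j : J} (hφ : φ j = normalizedEval Q y) :
    kernelRatio α Q n L φ (q, 0) (functionalVector ℂ ℂ[X] j) = -kernel01 α L c y := by
  have hdeg := natDegree_add_one_eq_of_mul_X_sub_C_eq hq (ne_zero_of_forall_eval_ne_zero hQ)
  have hdeg' := natDegree_mul_X_sub_C_le (p := q) y
  have hnil := isCharRatioNumerator_nil_nil Q
  have hr := isCharRatioNumerator_singleton_singleton hq y
  rw [kernelRatio, skewGramRatio_inl_functionalVector _ φ hq
      (hasTransitionDet_extendedMultiples_X_sub_C c y L)
      fun a => by rw [hφ, normalizedEval_powerMultiples_mul_X_sub_C],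
    hφ, mul_one, normalizedEval_eq_inv_sub hq hy, kernel01, cauchyNormalization_eq_gramDet hρ hQ hn,
    cauchyPartition_eq_gramDet_quotientWeight hρ hQ hnil hr hn (by lia),
    cauchyPartition_eq_gramDet_quotientWeight hρ hQ hr hnil (by lia) hn, ← neg_sub c y, inv_neg,
    one_mul, neg_mul, inv_mul_eq_div, div_div]

theorem kernelRatio_normalizedEval (hρ : HasMoments (quotientWeight α Q) n)
    (hQ : ∀ x : ℝ, 0 < x → Q.eval (x : ℂ) ≠ 0) (hn : Q.natDegree + (L + 1) ≤ n)
    {φ : J → ℂ[X] →ₗ[ℂ] ℂ} {y z : ℂ} (hy : Q.eval y ≠ 0) (hz : Q.eval z ≠ 0) {i j : J}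
    (hi : φ i = normalizedEval Q y) (hj : φ j = normalizedEval Q z) :
    kernelRatio α Q n (L + 1) φ (functionalVector ℂ ℂ[X] i) (functionalVector ℂ ℂ[X] j) =
      kernel00 α L y z := by
  have hdeg (y : ℂ) := natDegree_mul_X_sub_C_le (p := Q) y
  have hr := isCharRatioNumerator_nil_singleton Q
  rw [kernelRatio, skewGramRatio_functionalVector _ φ
      (hasTransitionDet_extendedMultiples_one_X_sub_C z L)
      (hasTransitionDet_extendedMultiples_one_X_sub_C y L)
      (fun a => by rw [hj, normalizedEval_powerMultiples_mul_X_sub_C])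
      (fun a => by rw [hi, normalizedEval_powerMultiples_mul_X_sub_C]),
    hi, hj, mul_one Q, normalizedEval_self hy, normalizedEval_self hz, mul_one ((-1 : ℂ) ^ L),
    pow_mul_pow_eq_one L (by norm_num), one_mul, kernel00, cauchyNormalization_eq_gramDet hρ hQ hn,
    cauchyPartition_eq_gramDet_quotientWeight hρ hQ (hr z) (hr y) (by grind) (by grind),
    cauchyPartition_eq_gramDet_quotientWeight hρ hQ (hr y) (hr z) (by grind) (by grind)]

theorem kernelRatio_inl_signedCoeff (hρ : HasMoments (quotientWeight α Q) n)
    (hQ : ∀ x : ℝ, 0 < x → Q.eval (x : ℂ) ≠ 0) (hQm : Q.Monic) (hn : Q.natDegree + (L + 1) ≤ n)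
    {φ : J → ℂ[X] →ₗ[ℂ] ℂ} {c : ℂ} {q : ℂ[X]} (hq : q * (X - C c) = Q) {j : J}
    (hφ : φ j = signedCoeff Q.natDegree L) :
    kernelRatio α Q n (L + 1) φ (q, 0) (functionalVector ℂ ℂ[X] j) = -kernel1 α (L + 1) c := by
  have hqm : q.Monic := Monic.of_mul_monic_right (monic_X_sub_C c) (hq ▸ hQm)
  have hdeg := natDegree_add_one_eq_of_mul_X_sub_C_eq hq hQm.ne_zero
  have hzero (a : Fin (L + 1)) : signedCoeff Q.natDegree L (powerMultiples (q * 1) (L + 1) a) = 0 :=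
    signedCoeff_eq_zero (by rw [mul_one, natDegree_powerMultiples hqm]; lia)
  have hlead : signedCoeff Q.natDegree L (q * X ^ (L + 1)) = (-1) ^ L :=
    signedCoeff_of_monic (hqm.mul (monic_X_pow _))
      (by rw [hqm.natDegree_mul (monic_X_pow _), natDegree_X_pow]; lia)
  have hsign : (-1 : ℂ) ^ (L + 1) * (-1) ^ L = -1 := by
    rw [pow_succ', mul_assoc, pow_mul_pow_eq_one L (by norm_num), mul_one]
  have hnil := isCharRatioNumerator_nil_nil Q
  have hr := isCharRatioNumerator_singleton_nil hq
  rw [kernelRatio, skewGramRatio_inl_functionalVector _ φ hq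
      (hasTransitionDet_extendedMultiples_one c (L + 1)) fun a => by rw [hφ, hzero],
    hφ, hlead, hsign, mul_one, neg_one_mul, kernel1, cauchyNormalization_eq_gramDet hρ hQ hn,
    cauchyPartition_eq_gramDet_quotientWeight hρ hQ hnil hr hn (by lia),
    cauchyPartition_eq_gramDet_quotientWeight hρ hQ hr hnil (by lia) hn]

theorem kernelRatio_normalizedEval_signedCoeff (hρ : HasMoments (quotientWeight α Q) n)
    (hQ : ∀ x : ℝ, 0 < x → Q.eval (x : ℂ) ≠ 0) (hQm : Q.Monic) (hn : Q.natDegree + (L + 1) ≤ n)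
    {φ : J → ℂ[X] →ₗ[ℂ] ℂ} {y : ℂ} (hy : Q.eval y ≠ 0) {i j : J} (hi : φ i = normalizedEval Q y)
    (hj : φ j = signedCoeff Q.natDegree L) :
    kernelRatio α Q n (L + 1) φ (functionalVector ℂ ℂ[X] i) (functionalVector ℂ ℂ[X] j) =
      kernel0 α L y := by
  have hdeg := natDegree_mul_X_sub_C_le (p := Q) y
  have hzero (a : Fin L) : signedCoeff Q.natDegree L (powerMultiples (Q * 1) L a) = 0 :=
    signedCoeff_eq_zero (by rw [mul_one, natDegree_powerMultiples hQm]; lia)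
  have hlead : signedCoeff Q.natDegree L (Q * X ^ L) = (-1) ^ L :=
    signedCoeff_of_monic (hQm.mul (monic_X_pow _))
      (by rw [hQm.natDegree_mul (monic_X_pow _), natDegree_X_pow])
  have hnil := isCharRatioNumerator_nil_nil Q
  have hr := isCharRatioNumerator_nil_singleton Q y
  rw [kernelRatio, skewGramRatio_functionalVector _ φ (.refl _)
      (hasTransitionDet_extendedMultiples_one_X_sub_C y L) (fun a => by rw [hj, hzero])
      (fun a => by rw [hi, normalizedEval_powerMultiples_mul_X_sub_C]),
    hi, hj, hlead, mul_one Q, normalizedEval_self hy, mul_one ((-1 : ℂ) ^ L), one_mul,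
    pow_mul_pow_eq_one L (by norm_num), one_mul, kernel0, cauchyNormalization_eq_gramDet hρ hQ hn,
    cauchyPartition_eq_gramDet_quotientWeight hρ hQ hnil hr (by lia) (by lia),
    cauchyPartition_eq_gramDet_quotientWeight hρ hQ hr hnil (by lia) (by lia)]

end KernelEntries

section DeterminantalFormula

variable {k l : ℕ} {kap : Fin k → ℂ} {lam : Fin l → ℂ}

theorem mixedCauchyVandermonde_ne_zero (hkap : Function.Injective kap)
    (hlam : Function.Injective lam) (hdisj : ∀ i j, kap i ≠ lam j) :
    mixedCauchyVandermonde kap lam ≠ 0 :=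
  div_ne_zero (mul_ne_zero (vandermondeProd_ne_zero hkap) (vandermondeProd_ne_zero hlam))
    (prod_ne_zero_iff.2 fun i _ => prod_ne_zero_iff.2 fun j _ => sub_ne_zero.2 (hdisj i j))

theorem det_normalizedEval_pow (Q : ℂ[X]) (lam : Fin l → ℂ) :
    (of fun i j : Fin l => normalizedEval Q (lam j) (X ^ (i : ℕ))).det =
      (∏ j, Q.eval (lam j))⁻¹ * vandermondeProd lam := by
  rw [vandermondeProd, ← det_vandermonde, ← det_transpose (vandermonde lam), ← prod_inv_distrib,
    ← det_mul_row]
  congr 1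
  ext i j
  simp only [of_apply, normalizedEval_apply, eval_pow, eval_X, transpose_apply, vandermonde_apply]

theorem det_normalizedEval_nodal_pow_sq_mul (kap : Fin k → ℂ) (lam : Fin l → ℂ) :
    (of fun i j : Fin l => normalizedEval (nodal univ kap) (lam j) (X ^ (i : ℕ))).det ^ 2 *
      vandermondeProd kap ^ 2 = mixedCauchyVandermonde kap lam ^ 2 := by
  have hsq : (∏ j, (nodal univ kap).eval (lam j)) ^ 2 = (∏ i, ∏ j, (kap i - lam j)) ^ 2 := by
    rw [prod_comm]
    simp only [eval_nodal, ← prod_pow]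
    exact prod_congr rfl fun j _ => prod_congr rfl fun i _ => sub_sq_comm _ _
  rw [det_normalizedEval_pow, mixedCauchyVandermonde, div_pow, ← hsq]
  ring

theorem eval_nodal_ofReal_ne_zero (hkap : ∀ i, ∀ t : ℝ, 0 ≤ t → kap i ≠ t) (x : ℝ) (hx : 0 < x) :
    (nodal univ kap).eval (x : ℂ) ≠ 0 :=
  eval_nodal_not_at_node fun i _ => (hkap i x hx.le).symm

theorem normalizedEval_nodal_mul (Q p : ℂ[X]) (lam : Fin l → ℂ) (j : Fin l) :
    normalizedEval Q (lam j) (nodal univ lam * p) = 0 := by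
  rw [normalizedEval_apply, eval_mul, eval_nodal_at_node (mem_univ j), zero_mul, mul_zero]

theorem nodal_erase_mul_X_sub_C (kap : Fin k → ℂ) (i : Fin k) :
    nodal (univ.erase i) kap * (X - C (kap i)) = nodal univ kap := by
  rw [mul_comm, ← nodal_eq_mul_nodal_erase (mem_univ i)]

variable {J : Type*} [Fintype J] [DecidableEq J] {α : ℝ → ℂ} {n L : ℕ}

theorem cauchyPartition_mul_eq_det_kernelRatio {N : ℕ} (hkap : ∀ i, ∀ t : ℝ, 0 ≤ t → kap i ≠ t)
    (hkap_inj : Function.Injective kap) (hL : 0 < L) (hα : HasMoments α L)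
    (hZ : cauchyNormalization α L ≠ 0) (φ : J → ℂ[X] →ₗ[ℂ] ℂ) {c : J → ℂ[X]}
    (hc : ∀ j, (c j).Monic) (e : Fin N ⊕ J ≃ Fin (k + L))
    (hlamdeg : ∀ a : Fin N, l + a = e (Sum.inl a)) (hcdeg : ∀ j, (c j).natDegree = e (Sum.inr j))
    (hφ : ∀ j (a : Fin N), φ j (nodal univ lam * X ^ (a : ℕ)) = 0)
    (hlN : l + N ≤ k + L) (heven : Even (k + Fintype.card J)) :
    cauchyPartition α N kap lam kap lam * (of fun i j => φ j (c i)).det ^ 2 *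
        vandermondeProd kap ^ 2 =
      cauchyNormalization α L * (of fun s t => kernelRatio α (nodal univ kap) (k + L) L φ
        (borderVector kap s) (borderVector kap t)).det := by
  have hρ := hα.quotientWeight_nodal hL hkap
  have hQ := eval_nodal_ofReal_ne_zero hkap
  have hdeg {m : ℕ} (u : Fin m → ℂ) : (nodal univ u).natDegree = m := by
    rw [natDegree_nodal, card_fin]
  have hnorm := cauchyNormalization_eq_gramDet hρ hQ (L := L) (by rw [hdeg])
  have hnum := isCharRatioNumerator_nodal kap lam
  rw [cauchyPartition_eq_gramDet_quotientWeight hρ hQ hnum hnum (by rwa [hdeg]) (by rwa [hdeg]),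
    hnorm]
  exact gramDet_mul_eq_det_skewGramRatio (cauchyForm_add_swap hρ) φ hkap_inj rfl nodal_monic hc e
    (fun a => by rw [hdeg, hlamdeg]) hcdeg hφ (hnorm ▸ hZ) heven

theorem kernelRatio_borderVector (hρ : HasMoments (quotientWeight α (nodal univ kap)) n)
    (hn : k + (L + 1) ≤ n) (hkap : ∀ i, ∀ t : ℝ, 0 ≤ t → kap i ≠ t)
    (hdisj : ∀ i j, kap i ≠ lam j) {φ : J → ℂ[X] →ₗ[ℂ] ℂ} {ν : Fin l → J}
    (hφ : ∀ j, φ (ν j) = normalizedEval (nodal univ kap) (lam j)) (s t : Fin k ⊕ Fin l) :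
    kernelRatio α (nodal univ kap) n (L + 1) φ (borderVector kap (s.map id ν))
      (borderVector kap (t.map id ν)) = kernelMatrixEven α (L + 1) kap lam s t := by
  have hQ := eval_nodal_ofReal_ne_zero hkap
  have hlam (j) : (nodal univ kap).eval (lam j) ≠ 0 :=
    eval_nodal_not_at_node fun i _ => (hdisj i j).symm
  have hnQ : (nodal univ kap).natDegree + (L + 1) ≤ n := by rwa [natDegree_nodal, card_fin]
  have hκ := nodal_erase_mul_X_sub_C kap
  have h01 (i j) := kernelRatio_inl_normalizedEval hρ hQ hnQ (hκ i) (hlam j) (hφ j)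
  rcases s with i | i <;> rcases t with j | j
  · exact kernelRatio_inl hρ hQ hnQ φ (hκ i) (hκ j)
  · exact h01 i j
  · exact (skewGramRatio_swap _ _ _ _).trans ((congrArg _ (h01 j i)).trans (neg_neg _))
  · exact kernelRatio_normalizedEval hρ hQ hnQ (hlam i) (hlam j) (hφ i) (hφ j)

theorem cauchyPartition_eq_det_kernelMatrixEven {N : ℕ} (hN : N + l = k + (L + 1))
    (hkap : ∀ i, ∀ t : ℝ, 0 ≤ t → kap i ≠ t) (hkap_inj : Function.Injective kap)
    (hlam_inj : Function.Injective lam) (hdisj : ∀ i j, kap i ≠ lam j) (heven : Even (k + l))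
    (hα : HasMoments α (L + 1)) (hZ : cauchyNormalization α (L + 1) ≠ 0) :
    cauchyPartition α N kap lam kap lam =
      cauchyNormalization α (L + 1) / mixedCauchyVandermonde kap lam ^ 2 *
        (kernelMatrixEven α (L + 1) kap lam).det := by
  let e : Fin N ⊕ Fin l ≃ Fin (k + (L + 1)) :=
    ((Equiv.sumComm _ _).trans finSumFinEquiv).trans (finCongr (by rw [add_comm, hN]))
  have hmain := cauchyPartition_mul_eq_det_kernelRatio (lam := lam) hkap hkap_inj L.succ_pos hα hZ
    (fun j => normalizedEval (nodal univ kap) (lam j)) (c := fun j => X ^ (j : ℕ))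
    (fun j => monic_X_pow _) e (fun a => by simp [e]) (fun j => by simp [e])
    (fun j a => normalizedEval_nodal_mul _ _ lam j) (by rw [add_comm, hN])
    (by rwa [Fintype.card_fin])
  have hB := mixedCauchyVandermonde_ne_zero hkap_inj hlam_inj hdisj
  rw [mul_assoc, det_normalizedEval_nodal_pow_sq_mul] at hmain
  rw [div_mul_eq_mul_div, eq_div_iff (pow_ne_zero 2 hB), hmain]
  congr 2
  ext s t
  rw [← kernelRatio_borderVector (ν := id) (hα.quotientWeight_nodal L.succ_pos hkap) le_rfl hkap
    hdisj (φ := fun j => normalizedEval (nodal univ kap) (lam j)) (fun _ => rfl), Sum.map_id_id]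
  rfl

/-- The functionals bordering the form when `k + l` is odd: the evaluations at the `lam j`, and a
coefficient that makes the size of the border even. -/
noncomputable def evalCoeffFunctional (kap : Fin k → ℂ) (lam : Fin l → ℂ) (L : ℕ) :
    Fin l ⊕ Unit → ℂ[X] →ₗ[ℂ] ℂ :=
  Sum.elim (fun j => normalizedEval (nodal univ kap) (lam j)) fun _ => signedCoeff k L

theorem det_evalCoeffFunctional_pow_sq (kap : Fin k → ℂ) (lam : Fin l → ℂ) (hl : l ≤ k + L) :
    (of fun s t => evalCoeffFunctional kap lam L t
      (Sum.elim (fun j : Fin l => (X : ℂ[X]) ^ (j : ℕ)) (fun _ : Unit => X ^ (k + L)) s)).det ^ 2 =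
      (of fun i j : Fin l => normalizedEval (nodal univ kap) (lam j) (X ^ (i : ℕ))).det ^ 2 := by
  have hblocks : (of fun s t => evalCoeffFunctional kap lam L t
      (Sum.elim (fun j : Fin l => (X : ℂ[X]) ^ (j : ℕ)) (fun _ : Unit => X ^ (k + L)) s)) =
      fromBlocks (of fun i j : Fin l => normalizedEval (nodal univ kap) (lam j) (X ^ (i : ℕ))) 0
        (of fun _ j => normalizedEval (nodal univ kap) (lam j) (X ^ (k + L)))
        (of fun _ _ => (-1) ^ L) := by
    ext (i | _) (j | _)
    · rfl
    · exact signedCoeff_eq_zero (by simpa using i.isLt.trans_le hl)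
    · rfl
    · exact signedCoeff_of_monic (monic_X_pow _) (natDegree_X_pow _)
  rw [hblocks, det_fromBlocks_zero₁₂, det_unique (n := Unit), of_apply, mul_pow, ← pow_mul,
    mul_comm L, pow_mul, neg_one_sq, one_pow, mul_one]

theorem cauchyPartition_mul_eq_det_kernelRatio_evalCoeffFunctional {N : ℕ} (hN : N + l = k + L)
    (hkap : ∀ i, ∀ t : ℝ, 0 ≤ t → kap i ≠ t) (hkap_inj : Function.Injective kap)
    (hodd : Odd (k + l)) (hα : HasMoments α (L + 1)) (hZ : cauchyNormalization α (L + 1) ≠ 0) :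
    cauchyPartition α N kap lam kap lam * mixedCauchyVandermonde kap lam ^ 2 =
      cauchyNormalization α (L + 1) * (of fun s t => kernelRatio α (nodal univ kap) (k + (L + 1))
        (L + 1) (evalCoeffFunctional kap lam L) (borderVector kap s) (borderVector kap t)).det := by
  let e : Fin N ⊕ (Fin l ⊕ Unit) ≃ Fin (k + (L + 1)) :=
    (((Equiv.sumAssoc (Fin N) (Fin l) Unit).symm.trans
      (((Equiv.sumComm (Fin N) (Fin l)).trans finSumFinEquiv).sumCongr finOneEquiv.symm)).trans
        finSumFinEquiv).trans (finCongr (by lia))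
  let c : Fin l ⊕ Unit → ℂ[X] := Sum.elim (fun j => X ^ (j : ℕ)) fun _ => X ^ (k + L)
  have hc (j) : (c j).Monic := by rcases j with j | _ <;> exact monic_X_pow _
  have hcdeg (j) : (c j).natDegree = e (Sum.inr j) := by
    rcases j with j | _ <;> simp [c, e, ← hN, add_comm]
  have hφ (j) (a : Fin N) :
      evalCoeffFunctional kap lam L j (nodal univ lam * X ^ (a : ℕ)) = 0 := by
    rcases j with j | _
    · exact normalizedEval_nodal_mul _ _ lam j
    · refine signedCoeff_eq_zero ?_
      rw [nodal_monic.natDegree_mul (monic_X_pow _), natDegree_nodal, card_fin, natDegree_X_pow]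
      lia
  have hmain := cauchyPartition_mul_eq_det_kernelRatio hkap hkap_inj L.succ_pos hα hZ _ hc e
    (fun a => by simp [e]) hcdeg hφ (by lia)
    (by simpa [← add_assoc] using hodd.add_one)
  rwa [det_evalCoeffFunctional_pow_sq kap lam (by lia), mul_assoc,
    det_normalizedEval_nodal_pow_sq_mul] at hmain

theorem kernelMatrixOdd_inr_inl (α : ℝ → ℂ) (L : ℕ) (kap : Fin k → ℂ) (lam : Fin l → ℂ)
    (s : Fin k ⊕ Fin l) (u v : Unit) : kernelMatrixOdd α L kap lam (Sum.inr u) (Sum.inl s) =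
      -kernelMatrixOdd α L kap lam (Sum.inl s) (Sum.inr v) := by
  rcases s with i | i
  · exact (neg_neg _).symm
  · rfl

theorem kernelRatio_borderVector_functionalVector
    (hρ : HasMoments (quotientWeight α (nodal univ kap)) n) (hn : k + (L + 1) ≤ n)
    (hkap : ∀ i, ∀ t : ℝ, 0 ≤ t → kap i ≠ t) (hdisj : ∀ i j, kap i ≠ lam j) (s : Fin k ⊕ Fin l)
    (u : Unit) :
    kernelRatio α (nodal univ kap) n (L + 1) (evalCoeffFunctional kap lam L)
      (borderVector kap (s.map id Sum.inl)) (functionalVector ℂ ℂ[X] (Sum.inr u)) =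
        kernelMatrixOdd α (L + 1) kap lam (Sum.inl s) (Sum.inr u) := by
  have hQ := eval_nodal_ofReal_ne_zero hkap
  have hdeg : (nodal univ kap).natDegree = k := by rw [natDegree_nodal, card_fin]
  have hcoeff : evalCoeffFunctional kap lam L (Sum.inr u) =
      signedCoeff (nodal univ kap).natDegree L := by rw [hdeg]; rfl
  rcases s with i | i
  · exact kernelRatio_inl_signedCoeff hρ hQ nodal_monic (by rwa [hdeg])
      (nodal_erase_mul_X_sub_C kap i) hcoeff
  · exact kernelRatio_normalizedEval_signedCoeff hρ hQ nodal_monic (by rwa [hdeg])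
      (eval_nodal_not_at_node fun i' _ => (hdisj i' i).symm) rfl hcoeff

theorem kernelRatio_borderVector_evalCoeffFunctional
    (hρ : HasMoments (quotientWeight α (nodal univ kap)) n) (hn : k + (L + 1) ≤ n)
    (hkap : ∀ i, ∀ t : ℝ, 0 ≤ t → kap i ≠ t) (hdisj : ∀ i j, kap i ≠ lam j) :
    (of fun s t => kernelRatio α (nodal univ kap) n (L + 1) (evalCoeffFunctional kap lam L)
      (borderVector kap s) (borderVector kap t)).submatrix (Equiv.sumAssoc _ _ _)
        (Equiv.sumAssoc _ _ _) = kernelMatrixOdd α (L + 1) kap lam := by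
  have hassoc (s : Fin k ⊕ Fin l) :
      Equiv.sumAssoc (Fin k) (Fin l) Unit (Sum.inl s) = s.map id Sum.inl := by
    rcases s with i | i <;> rfl
  ext (s | _) (t | _)
  · rw [submatrix_apply, hassoc, hassoc]
    exact kernelRatio_borderVector hρ hn hkap hdisj (ν := Sum.inl) (fun _ => rfl) s t
  · rw [submatrix_apply, hassoc]
    exact kernelRatio_borderVector_functionalVector hρ hn hkap hdisj s _
  · rw [submatrix_apply, hassoc, kernelMatrixOdd_inr_inl,
      ← kernelRatio_borderVector_functionalVector hρ hn hkap hdisj t]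
    exact skewGramRatio_swap _ _ _ _
  · exact skewGramRatio_self _ _ _

theorem cauchyPartition_eq_det_kernelMatrixOdd {N : ℕ} (hN : N + l = k + L)
    (hkap : ∀ i, ∀ t : ℝ, 0 ≤ t → kap i ≠ t) (hkap_inj : Function.Injective kap)
    (hlam_inj : Function.Injective lam) (hdisj : ∀ i j, kap i ≠ lam j) (hodd : Odd (k + l))
    (hα : HasMoments α (L + 1)) (hZ : cauchyNormalization α (L + 1) ≠ 0) :
    cauchyPartition α N kap lam kap lam =
      cauchyNormalization α (L + 1) / mixedCauchyVandermonde kap lam ^ 2 *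
        (kernelMatrixOdd α (L + 1) kap lam).det := by
  have hB := mixedCauchyVandermonde_ne_zero hkap_inj hlam_inj hdisj
  rw [div_mul_eq_mul_div, eq_div_iff (pow_ne_zero 2 hB),
    cauchyPartition_mul_eq_det_kernelRatio_evalCoeffFunctional hN hkap hkap_inj hodd hα hZ,
    ← kernelRatio_borderVector_evalCoeffFunctional (hα.quotientWeight_nodal L.succ_pos hkap)
      le_rfl hkap hdisj,
    det_submatrix_equiv_self]

end DeterminantalFormula

theorem mainTheorem2 (N k l : ℕ) (hN : k + 1 < N + l) (α : ℝ → ℂ)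
    (kap : Fin k → ℂ) (lam : Fin l → ℂ)
    (hkap : ∀ i, ∀ t : ℝ, 0 ≤ t → kap i ≠ (t : ℂ))
    (hkap_inj : Function.Injective kap) (hlam_inj : Function.Injective lam)
    (hdisj : ∀ i j, kap i ≠ lam j) :
    (Even (k + l) →
      (∀ n < N + l - k, IntegrableOn (fun x : ℝ => (x : ℂ) ^ n * α x) (Set.Ioi 0)) →
      cauchyNormalization α (N + l - k) ≠ 0 →
      cauchyPartition α N kap lam kap lam =
        cauchyNormalization α (N + l - k) / mixedCauchyVandermonde kap lam ^ 2 *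
          (kernelMatrixEven α (N + l - k) kap lam).det) ∧
    (Odd (k + l) →
      (∀ n < N + l - k + 1, IntegrableOn (fun x : ℝ => (x : ℂ) ^ n * α x) (Set.Ioi 0)) →
      cauchyNormalization α (N + l - k + 1) ≠ 0 →
      cauchyPartition α N kap lam kap lam =
        cauchyNormalization α (N + l - k + 1) / mixedCauchyVandermonde kap lam ^ 2 *
          (kernelMatrixOdd α (N + l - k + 1) kap lam).det) := by
  constructor <;> intro hparity hα hZ
  · obtain ⟨L, hL⟩ : ∃ L, N + l - k = L + 1 := Nat.exists_eq_succ_of_ne_zero (by lia)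
    rw [hL] at hα hZ ⊢
    exact cauchyPartition_eq_det_kernelMatrixEven (by lia) hkap hkap_inj hlam_inj hdisj hparity
      hα hZ
  · exact cauchyPartition_eq_det_kernelMatrixOdd (by lia) hkap hkap_inj hlam_inj hdisj hparity
      hα hZ
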